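/- Let $k$ be a field and let $\mathcal T$ be a $k$-linear triangulated category with small coproducts and a compact generator $G$, i.e. $G$ is compact and an object $X$ with $\mathrm{Hom}_{\mathcal T}(G[i],X)=0$ for all $i\in\mathbb Z$ is zero. Let $\mathcal T^{\le 0}$ be the smallest full subcategory of $\mathcal T$ that contains $G[j]$ for all $j\ge 0$ and is closed under direct summands, small coproducts and extensions, and let $\mathcal T^{\ge 0}$ be the right orthogonal of the smallest full subcategory that contains $G[j]$ for all $j\ge 1$ and is closed under the same operations; this is a $t$-structure on $\mathcal T$. Put $\mathcal T^{\le n}=\mathcal T^{\le 0}[-n]$, $\mathcal T^{\ge n}=\mathcal T^{\ge 0}[-n]$, and let $\mathbf H^i=\mathbf H^0\circ[i]$ be the associated cohomology functors with values in the heart. Let $\mathcal E$ be the smallest thick subcategory of $\mathcal T$ containing the Brown--Comenetz duals of all compact objects, where an object $X$ is a Brown--Comenetz dual of $C$ if there is a $k$-linear natural isomorphism $\mathrm{Hom}_{\mathcal T}(-,X)\simeq \mathrm{Hom}_k(\mathrm{Hom}_{\mathcal T}(C,-),k)$. Let $\mathcal T^+_c$ be the full subcategory of those objects $X$ such that for every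 integer $m>0$ there is a distinguished triangle $D\to X\to F\to D[1]$ with $F\in\mathcal E$ and $D\in\mathcal T^{\ge m}$. A strong $\mathcal E$-coapproximating system is a sequence $\cdots\xrightarrow{f_3}E_3\xrightarrow{f_2}E_2\xrightarrow{f_1}E_1$ of objects of $\mathcal E$ such that for every $m\ge 1$ the morphism $\mathbf H^i(f_m)$ is an isomorphism for all integers $i\le m$. A homotopy limit of such a sequence is an object $X$ that fits into a distinguished triangle $$X\longrightarrow \prod_{m\ge 1}E_m\xrightarrow{\,1-p\,}\prod_{m\ge 1}E_m\longrightarrow X[1],$$ where the $m$-th component of $p$ is the projection to $E_{m+1}$ followed by $f_m$. Assume that there is an integer $n>0$ with $\mathrm{Hom}_{\mathcal T}(G,G[i])=0$ for all $i\ge n$, and that $\mathcal T^{\le 0}$ is closed under small products. Then every strong $\mathcal E$-coapproximating system has a homotopy limit, and $$\mathcal T^+_c=\{\,X\in\mathcal T \mid X \text{ is a homotopy limit of a strong } \mathcal E\text{-coapproximating system}\,\}.$$ -/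

import Mathlib

open CategoryTheory CategoryTheory.Limits CategoryTheory.Pretriangulated
open CategoryTheory.Triangulated

universe w v u

namespace CompactGen

section Basic

variable {T : Type u} [Category.{v} T] [Preadditive T]

/-- An object `C` is compact if `Hom(C, -)`, with values in abelian groups, preserves all small
coproducts. -/
def IsCompactObject (C : T) : Prop :=
  ∀ J : Type v, PreservesColimitsOfShape (Discrete J) (preadditiveCoyoneda.obj (Opposite.op C))

/-- In a coproduct of abelian groups every element is a finite sum of elements coming from the
summands. -/
lemma exists_sum_of_isColimit {J : Type v} (F : Discrete J ⥤ AddCommGrpCat.{v}) (c : Cocone F)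
    (hc : IsColimit c) (x : c.pt) :
    ∃ (s : Finset J) (g : ∀ j : J, F.obj ⟨j⟩), x = ∑ j ∈ s, (c.ι.app ⟨j⟩).hom (g j) := by
  classical
  let S : AddSubgroup c.pt := AddSubgroup.closure
    {y | ∃ (j : J) (z : F.obj ⟨j⟩), y = (c.ι.app ⟨j⟩).hom z}
  let q : c.pt ⟶ AddCommGrpCat.of (c.pt ⧸ S) := AddCommGrpCat.ofHom (QuotientAddGroup.mk' S)
  have hq : q = 0 := by
    apply hc.hom_ext
    rintro ⟨j⟩
    ext z
    simp only [comp_zero]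
    change (QuotientAddGroup.mk' S) ((c.ι.app ⟨j⟩).hom z) = 0
    rw [QuotientAddGroup.mk'_apply, QuotientAddGroup.eq_zero_iff]
    exact AddSubgroup.subset_closure ⟨j, z, rfl⟩
  have hx : x ∈ S := by
    rw [← QuotientAddGroup.eq_zero_iff]
    change q.hom x = 0
    rw [hq]; rfl
  induction hx using AddSubgroup.closure_induction with
  | mem y hy =>
    obtain ⟨j, z, rfl⟩ := hy
    refine ⟨{j}, Function.update (fun _ => 0) j z, ?_⟩
    simp
  | zero => exact ⟨∅, fun _ => 0, by simp⟩
  | add y z _ _ hy hz =>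
    obtain ⟨s, g, rfl⟩ := hy
    obtain ⟨t, h, rfl⟩ := hz
    refine ⟨s ∪ t, fun j => (if j ∈ s then g j else 0) + (if j ∈ t then h j else 0), ?_⟩
    simp only [map_add, Finset.sum_add_distrib]
    congr 1
    · rw [← Finset.sum_subset (Finset.subset_union_left (s₁ := s) (s₂ := t))]
      · exact Finset.sum_congr rfl fun j hj => by simp [hj]
      · intro j _ hj
        simp [hj]
    · rw [← Finset.sum_subset (Finset.subset_union_right (s₁ := s) (s₂ := t))]
      · exact Finset.sum_congr rfl fun j hj => by simp [hj]
      · intro j _ hj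
        simp [hj]
  | neg y _ hy =>
    obtain ⟨s, g, rfl⟩ := hy
    exact ⟨s, fun j => -g j, by simp⟩

/-- A morphism from a compact object to a coproduct is a finite sum of morphisms through the
summands. -/
lemma IsCompactObject.exists_sum {C : T} (hC : IsCompactObject C) {J : Type v} {X : J → T}
    (c : Cofan X) (hc : IsColimit c) (f : C ⟶ c.pt) :
    ∃ (s : Finset J) (g : ∀ j : J, C ⟶ X j), f = ∑ j ∈ s, g j ≫ c.inj j := by
  have := hC J
  exact exists_sum_of_isColimit _ _
    (isColimitOfPreserves (preadditiveCoyoneda.obj (Opposite.op C)) hc) f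

end Basic

section Triang

variable {T : Type u} [Category.{v} T] [Preadditive T] [HasZeroObject T] [HasShift T ℤ]
  [∀ n : ℤ, (shiftFunctor T n).Additive] [Pretriangulated T]

/-- A compact generator: a compact object `G` such that the only objects `X` with
`Hom(G[i], X) = 0` for all integers `i` are the zero objects. -/
structure IsCompactGenerator (G : T) : Prop where
  compact : IsCompactObject G
  generates : ∀ X : T, (∀ (i : ℤ) (f : G⟦i⟧ ⟶ X), f = 0) → IsZero X

/-- The smallest full subcategory of `T` which contains `G[-i]` for all integers `i ≤ b` and is
closed under direct summands, small coproducts and extensions. -/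
inductive GenLE (G : T) (b : ℤ) : ObjectProperty T
  | shift (i : ℤ) (hi : i ≤ b) : GenLE G b (G⟦-i⟧)
  | retract {X Y : T} (r : Retract X Y) (hY : GenLE G b Y) : GenLE G b X
  | coproduct {J : Type v} (X : J → T) (c : Cofan X) (hc : IsColimit c)
      (hX : ∀ j, GenLE G b (X j)) : GenLE G b c.pt
  | extension (D : Triangle T) (hD : D ∈ distTriang T) (h₁ : GenLE G b D.obj₁)
      (h₃ : GenLE G b D.obj₃) : GenLE G b D.obj₂

lemma GenLE.of_iso {G : T} {b : ℤ} {X Y : T} (e : X ≅ Y) (hX : GenLE G b X) : GenLE G b Y :=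
  GenLE.retract ⟨e.inv, e.hom, e.inv_hom_id⟩ hX

instance (G : T) (b : ℤ) : (GenLE G b).IsClosedUnderIsomorphisms where
  of_iso e h := h.of_iso e

lemma GenLE.mono {G : T} {a b : ℤ} (hab : a ≤ b) {X : T} (hX : GenLE G a X) : GenLE G b X := by
  induction hX with
  | shift i hi => exact .shift i (hi.trans hab)
  | retract r _ ih => exact .retract r ih
  | coproduct X c hc _ ih => exact .coproduct X c hc ih
  | extension D hD _ _ h₁ h₃ => exact .extension D hD h₁ h₃

/-- The image of a coproduct under a shift functor is a coproduct. -/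
noncomputable def isColimitShiftCofan {J : Type v} {X : J → T} (c : Cofan X) (hc : IsColimit c)
    (a : ℤ) : IsColimit (Cofan.mk (f := fun j => (X j)⟦a⟧) (c.pt⟦a⟧) fun j => (c.inj j)⟦a⟧') :=
  isColimitCofanMkObjOfIsColimit (shiftFunctor T a) X c.inj
    (IsColimit.ofIsoColimit hc (Cofan.ext (Iso.refl _)))

lemma GenLE.shift_obj {G : T} {b : ℤ} {X : T} (hX : GenLE G b X) (a b' : ℤ) (h : a + b' = b) :
    GenLE G b' (X⟦a⟧) := by
  induction hX with
  | shift i hi =>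
    exact (GenLE.shift (G := G) (i - a) (by lia)).of_iso
      ((shiftFunctorAdd' T (-i) a (-(i - a)) (by lia)).app G)
  | retract r _ ih => exact .retract (r.map (shiftFunctor T a)) ih
  | coproduct X c hc _ ih => exact .coproduct _ _ (isColimitShiftCofan c hc a) ih
  | extension D hD _ _ h₁ h₃ =>
    exact .extension _ (Triangle.shift_distinguished D hD a) h₁ h₃

lemma GenLE.shift_iff {G : T} {X : T} (a b b' : ℤ) (h : a + b' = b) :
    GenLE G b' (X⟦a⟧) ↔ GenLE G b X := by
  refine ⟨fun hX => ?_, fun hX => hX.shift_obj a b' h⟩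
  exact (hX.shift_obj (-a) b (by lia)).of_iso ((shiftEquiv T a).unitIso.symm.app X)

lemma GenLE.hom_eq_zero {G : T} {b : ℤ} {Y : T}
    (hY : ∀ i : ℤ, i ≤ b → ∀ f : G⟦-i⟧ ⟶ Y, f = 0) {X : T} (hX : GenLE G b X) (f : X ⟶ Y) :
    f = 0 := by
  induction hX with
  | shift i hi => exact hY i hi f
  | retract r _ ih => rw [← Category.id_comp f, ← r.retract, Category.assoc, ih (r.r ≫ f), comp_zero]
  | coproduct X c hc _ ih =>
    exact Cofan.IsColimit.hom_ext hc _ _ fun j => (ih j _).trans comp_zero.symm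
  | extension D hD _ _ h₁ h₃ =>
    obtain ⟨g, rfl⟩ := Triangle.yoneda_exact₂ D hD f (h₁ _)
    rw [h₃ g, comp_zero]

set_option linter.unusedSectionVars false in
/-- Homs out of a shift of a compact object into a coproduct. -/
lemma IsCompactObject.shift_exists_sum {C : T} (hC : IsCompactObject C) (a : ℤ) {J : Type v}
    {X : J → T} (c : Cofan X) (hc : IsColimit c) (f : C⟦a⟧ ⟶ c.pt) :
    ∃ (s : Finset J) (g : ∀ j : J, C⟦a⟧ ⟶ X j), f = ∑ j ∈ s, g j ≫ c.inj j := by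
  let e : C ≅ (C⟦a⟧)⟦-a⟧ := (shiftEquiv T a).unitIso.app C
  obtain ⟨s, g, hg⟩ := hC.exists_sum (Cofan.mk (f := fun j => (X j)⟦-a⟧) (c.pt⟦-a⟧) fun j =>
    (c.inj j)⟦-a⟧') (isColimitShiftCofan c hc (-a)) (e.hom ≫ f⟦-a⟧')
  refine ⟨s, fun j => (shiftFunctor T (-a)).preimage (e.inv ≫ g j), ?_⟩
  apply (shiftFunctor T (-a)).map_injective
  rw [← cancel_epi e.hom]
  refine hg.trans ?_
  rw [Functor.map_sum, Preadditive.comp_sum]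
  exact Finset.sum_congr rfl fun j _ => by
    rw [Functor.map_comp, Functor.map_preimage, Category.assoc, Iso.hom_inv_id_assoc]
    rfl

set_option linter.unusedSectionVars false in
/-- Any morphism into a stage of a sequence can be pushed forward to a later stage. -/
lemma exists_push {C L : T} {A : ℕ → T} (u : ∀ n, A n ⟶ A (n + 1)) (v : ∀ n, A n ⟶ L)
    (huv : ∀ n, u n ≫ v (n + 1) = v n) {n N : ℕ} (h : n ≤ N) (g : C ⟶ A n) :
    ∃ g' : C ⟶ A N, g ≫ v n = g' ≫ v N := by
  induction N, h using Nat.le_induction with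
  | base => exact ⟨g, rfl⟩
  | succ N _ ih =>
    obtain ⟨g', hg'⟩ := ih
    exact ⟨g' ≫ u N, by rw [hg', Category.assoc, huv]⟩

set_option linter.unusedSectionVars false in
lemma exists_push_sum {C L : T} {A : ℕ → T} (u : ∀ n, A n ⟶ A (n + 1)) (v : ∀ n, A n ⟶ L)
    (huv : ∀ n, u n ≫ v (n + 1) = v n) (s : Finset ℕ) (g : ∀ n, C ⟶ A n) :
    ∃ (N : ℕ) (g' : C ⟶ A N), ∑ n ∈ s, g n ≫ v n = g' ≫ v N := by
  classical
  induction s using Finset.induction_on with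
  | empty => exact ⟨0, 0, by simp⟩
  | insert a s ha ih =>
    obtain ⟨N, g', hg'⟩ := ih
    obtain ⟨g₁, h₁⟩ := exists_push u v huv (le_max_left a N) (g a)
    obtain ⟨g₂, h₂⟩ := exists_push u v huv (le_max_right a N) g'
    exact ⟨max a N, g₁ + g₂, by rw [Finset.sum_insert ha, hg', h₁, h₂, Preadditive.add_comp]⟩

variable [HasCoproducts.{v} T]

lemma exists_killing_step (G : T) {X A : T} (φ : A ⟶ X) (hA : GenLE G 0 A) :
    ∃ (A' : T) (φ' : A' ⟶ X) (p : A ⟶ A'), GenLE G 0 A' ∧ p ≫ φ' = φ ∧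
      ∀ (j : ℤ) (_ : -1 ≤ j) (f : G⟦j⟧ ⟶ A), f ≫ φ = 0 → f ≫ p = 0 := by
  let I : Type v := Σ n : ℕ, {f : G⟦(n : ℤ) - 1⟧ ⟶ A // f ≫ φ = 0}
  let Z : I → T := fun x => G⟦(x.1 : ℤ) - 1⟧
  let s : (∐ Z) ⟶ A := Sigma.desc fun x => x.2.1
  obtain ⟨A', p, δ, hD⟩ := distinguished_cocone_triangle s
  have hs : s ≫ φ = 0 := by
    apply Sigma.hom_ext
    intro x
    simp [s, x.2.2]
  obtain ⟨φ', hφ'⟩ := Triangle.yoneda_exact₂ _ hD φ hs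
  refine ⟨A', φ', p, ?_, hφ'.symm, ?_⟩
  · have hZ : GenLE G 1 (∐ Z) := by
      refine GenLE.coproduct Z _ (coproductIsCoproduct Z) fun x => ?_
      refine (GenLE.shift (G := G) (-((x.1 : ℤ) - 1)) (by lia)).of_iso (eqToIso ?_)
      rw [neg_neg]
    exact GenLE.extension _ (rot_of_distTriang _ hD) hA (hZ.shift_obj 1 0 (by norm_num))
  · intro j hj f hf
    obtain ⟨n, hn⟩ := Int.eq_ofNat_of_zero_le (show 0 ≤ j + 1 by lia)
    obtain rfl : j = (n : ℤ) - 1 := by lia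
    have h₁ : f = Sigma.ι Z ⟨n, f, hf⟩ ≫ s := by simp [s]
    have h₂ : s ≫ p = 0 := comp_distTriang_mor_zero₁₂ _ hD
    rw [h₁, Category.assoc, h₂, comp_zero]

/-- A morphism from an object of the subcategory generated by the `G[j]`, `j ≥ 0`, to `X`. -/
structure ApproxStage (G X : T) where
  obj : T
  hom : obj ⟶ X
  mem : GenLE G 0 obj

noncomputable def approxZero (G X : T) : ApproxStage G X where
  obj := ∐ fun x : (Σ n : ℕ, (G⟦(n : ℤ)⟧ ⟶ X)) => G⟦(x.1 : ℤ)⟧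
  hom := Sigma.desc fun x => x.2
  mem := by
    refine GenLE.coproduct _ _ (coproductIsCoproduct _) fun x => ?_
    refine (GenLE.shift (G := G) (-(x.1 : ℤ)) (by lia)).of_iso (eqToIso ?_)
    rw [neg_neg]

noncomputable def approxSucc {G X : T} (a : ApproxStage G X) : ApproxStage G X where
  obj := (exists_killing_step G a.hom a.mem).choose
  hom := (exists_killing_step G a.hom a.mem).choose_spec.choose
  mem := (exists_killing_step G a.hom a.mem).choose_spec.choose_spec.choose_spec.1

noncomputable def approxSeq (G X : T) : ℕ → ApproxStage G X
  | 0 => approxZero G X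
  | n + 1 => approxSucc (approxSeq G X n)

lemma exists_approxSeq_map (G X : T) (n : ℕ) :
    ∃ p : (approxSeq G X n).obj ⟶ (approxSeq G X (n + 1)).obj,
      p ≫ (approxSeq G X (n + 1)).hom = (approxSeq G X n).hom ∧
      ∀ (j : ℤ) (_ : -1 ≤ j) (f : G⟦j⟧ ⟶ (approxSeq G X n).obj),
        f ≫ (approxSeq G X n).hom = 0 → f ≫ p = 0 :=
  let a := approxSeq G X n
  ⟨_, (exists_killing_step G a.hom a.mem).choose_spec.choose_spec.choose_spec.2⟩

/-- Every object `X` receives a morphism from an object of the subcategory generated by the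
`G[j]`, `j ≥ 0`, that is surjective on `Hom(G[j], -)` for `j ≥ 0` and injective for `j ≥ -1`. -/
lemma exists_approx {G : T} (hG : IsCompactObject G) (X : T) :
    ∃ (A : T) (φ : A ⟶ X), GenLE G 0 A ∧
      (∀ (j : ℤ) (_ : 0 ≤ j) (f : G⟦j⟧ ⟶ X), ∃ f' : G⟦j⟧ ⟶ A, f = f' ≫ φ) ∧
      ∀ (j : ℤ) (_ : -1 ≤ j) (f : G⟦j⟧ ⟶ A), f ≫ φ = 0 → f = 0 := by
  classical
  choose p hp hkill using exists_approxSeq_map G X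
  let B : ULift.{v} ℕ → T := fun n => (approxSeq G X n.down).obj
  let ι : ∀ n : ℕ, (approxSeq G X n).obj ⟶ ∐ B := fun n => Sigma.ι B ⟨n⟩
  let σ : (∐ B) ⟶ ∐ B := Sigma.desc fun n => p n.down ≫ ι (n.down + 1)
  have hσ : ∀ n, ι n ≫ σ = p n ≫ ι (n + 1) := fun n => by simp [ι, σ]
  obtain ⟨A, q, δ, hD⟩ := distinguished_cocone_triangle (𝟙 (∐ B) - σ)
  let ψ : (∐ B) ⟶ X := Sigma.desc fun n => (approxSeq G X n.down).hom
  have hψ : ∀ n, ι n ≫ ψ = (approxSeq G X n).hom := fun n => by simp [ι, ψ]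
  have hσψ : (𝟙 (∐ B) - σ) ≫ ψ = 0 := by
    apply Sigma.hom_ext
    rintro ⟨n⟩
    change ι n ≫ (𝟙 (∐ B) - σ) ≫ ψ = ι n ≫ 0
    rw [Preadditive.sub_comp, Preadditive.comp_sub, ← Category.assoc (ι n) σ, hσ,
      Category.assoc, hψ, hp, Category.id_comp, hψ, sub_self, comp_zero]
  obtain ⟨φ, hφ⟩ : ∃ φ : A ⟶ X, ψ = q ≫ φ := Triangle.yoneda_exact₂ _ hD ψ hσψ
  have hq : (𝟙 (∐ B) - σ) ≫ q = 0 := comp_distTriang_mor_zero₁₂ _ hD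
  have hιq : ∀ n, p n ≫ ι (n + 1) ≫ q = ι n ≫ q := by
    intro n
    have : ι n ≫ (𝟙 (∐ B) - σ) ≫ q = 0 := by rw [hq, comp_zero]
    rw [Preadditive.sub_comp, Preadditive.comp_sub, Category.id_comp, ← Category.assoc (ι n) σ,
      hσ, Category.assoc, sub_eq_zero] at this
    exact this.symm
  have hB : GenLE G 0 (∐ B) :=
    GenLE.coproduct B _ (coproductIsCoproduct B) fun n => (approxSeq G X n.down).mem
  have hinj : ∀ (a : ℤ) (g : G⟦a⟧ ⟶ ∐ B), g ≫ (𝟙 (∐ B) - σ) = 0 → g = 0 := by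
    intro a g hg
    obtain ⟨s, h, hs⟩ := hG.shift_exists_sum a _ (coproductIsCoproduct B) g
    let π : ∀ m : ℕ, (∐ B) ⟶ (approxSeq G X m).obj := fun m =>
      Sigma.desc fun n => if e : n.down = m then eqToHom (by subst e; rfl) else 0
    have hπ : ∀ m, ι m ≫ π m = 𝟙 _ := fun m => by simp [ι, π]; rfl
    have hπ' : ∀ n m, n ≠ m → ι n ≫ π m = 0 := fun n m e => by simp [ι, π, e]
    have hσπ₀ : σ ≫ π 0 = 0 := by
      apply Sigma.hom_ext
      rintro ⟨n⟩
      change ι n ≫ σ ≫ π 0 = ι n ≫ 0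
      rw [← Category.assoc, hσ, Category.assoc, hπ' _ _ (by lia), comp_zero, comp_zero]
    have hσπ : ∀ m, σ ≫ π (m + 1) = π m ≫ p m := by
      intro m
      apply Sigma.hom_ext
      rintro ⟨n⟩
      change ι n ≫ σ ≫ π (m + 1) = ι n ≫ π m ≫ p m
      rw [← Category.assoc, hσ, Category.assoc, ← Category.assoc (ι n)]
      by_cases e : n = m
      · subst e
        rw [hπ, hπ, Category.comp_id, Category.id_comp]
      · rw [hπ' _ _ (by lia), hπ' _ _ e, comp_zero, zero_comp]
    have hgσ : g = g ≫ σ := by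
      rwa [Preadditive.comp_sub, Category.comp_id, sub_eq_zero] at hg
    have hgπ : ∀ m, g ≫ π m = 0 := by
      intro m
      induction m with
      | zero => rw [hgσ, Category.assoc, hσπ₀, comp_zero]
      | succ m ih => rw [hgσ, Category.assoc, hσπ, ← Category.assoc, ih, zero_comp]
    have hzero : ∀ n ∈ s, h n = 0 := by
      intro n hn
      have h₁ := hgπ n.down
      rw [hs, Preadditive.sum_comp, Finset.sum_eq_single n] at h₁
      · rw [Category.assoc] at h₁
        change h n ≫ ι n.down ≫ π n.down = 0 at h₁
        rw [hπ] at h₁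
        exact (Category.comp_id _).symm.trans h₁
      · intro n' _ hne
        rw [Category.assoc]
        change h n' ≫ ι n'.down ≫ π n.down = 0
        rw [hπ' _ _ (fun e => hne (ULift.ext _ _ e)), comp_zero]
      · exact fun hn' => absurd hn hn'
    rw [hs]
    exact Finset.sum_eq_zero fun n hn => by rw [hzero n hn, zero_comp]
  have hlift : ∀ (j : ℤ) (f : G⟦j⟧ ⟶ A), ∃ (N : ℕ) (g : G⟦j⟧ ⟶ (approxSeq G X N).obj),
      f = g ≫ ι N ≫ q := by
    intro j f
    have hfδ : f ≫ δ = 0 := by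
      let e : (G⟦j - 1⟧)⟦(1 : ℤ)⟧ ≅ G⟦j⟧ :=
        (shiftFunctorAdd' T (j - 1) 1 j (by lia)).symm.app G
      have h₁ : (f ≫ δ) ≫ (𝟙 (∐ B) - σ)⟦(1 : ℤ)⟧' = 0 := by
        rw [Category.assoc]
        have h₂ : δ ≫ (𝟙 (∐ B) - σ)⟦(1 : ℤ)⟧' = 0 := comp_distTriang_mor_zero₃₁ _ hD
        rw [h₂, comp_zero]
      obtain ⟨g, hg⟩ := (shiftFunctor T (1 : ℤ)).map_surjective (e.hom ≫ f ≫ δ)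
      have h₃ : g = 0 := by
        apply hinj (j - 1) g
        apply (shiftFunctor T (1 : ℤ)).map_injective
        rw [Functor.map_comp, hg, Category.assoc, h₁, comp_zero, Functor.map_zero]
      rw [← cancel_epi e.hom, ← hg, h₃, Functor.map_zero, comp_zero]
    obtain ⟨f', hf'⟩ := Triangle.coyoneda_exact₃ _ hD f hfδ
    obtain ⟨s, h, hs⟩ := hG.shift_exists_sum j _ (coproductIsCoproduct B) f'
    obtain ⟨N, g, hg⟩ := exists_push_sum p (fun n => ι n ≫ q) hιq
      (s.map ⟨ULift.down, ULift.down_injective⟩) (fun n => h ⟨n⟩)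
    refine ⟨N, g, ?_⟩
    rw [← hg, hf', hs]
    change (∑ j ∈ s, h j ≫ _) ≫ q = _
    rw [Preadditive.sum_comp, Finset.sum_map]
    exact Finset.sum_congr rfl fun n _ => Category.assoc _ _ _
  refine ⟨A, φ, ?_, ?_, ?_⟩
  · exact GenLE.extension _ (rot_of_distTriang _ hD) hB
      ((hB.mono (by norm_num : (0 : ℤ) ≤ 1)).shift_obj 1 0 (by norm_num))
  · intro j hj f
    obtain ⟨n, rfl⟩ := Int.eq_ofNat_of_zero_le hj
    let i₀ : G⟦(n : ℤ)⟧ ⟶ (approxSeq G X 0).obj :=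
      Sigma.ι (fun x : (Σ n : ℕ, (G⟦(n : ℤ)⟧ ⟶ X)) => G⟦(x.1 : ℤ)⟧) ⟨n, f⟩
    have hi₀ : i₀ ≫ (approxSeq G X 0).hom = f := by
      simp [i₀, approxSeq, approxZero]
    refine ⟨i₀ ≫ ι 0 ≫ q, ?_⟩
    rw [Category.assoc, Category.assoc, ← hφ, hψ, hi₀]
  · intro j hj f hf
    obtain ⟨N, g, rfl⟩ := hlift j f
    have hg : g ≫ (approxSeq G X N).hom = 0 := by
      rw [← hψ, hφ, ← hf, Category.assoc, Category.assoc]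
    rw [← hιq, ← Category.assoc, hkill N j hj g hg, zero_comp]

lemma exists_truncation {G : T} (hG : IsCompactObject G) (X : T) :
    ∃ (A Y : T) (_ : GenLE G 0 A) (_ : (GenLE G 0).rightOrthogonal Y)
      (f : A ⟶ X) (g : X ⟶ Y) (h : Y ⟶ A⟦(1 : ℤ)⟧), Triangle.mk f g h ∈ distTriang T := by
  obtain ⟨A, φ, hA, hsurj, hinj⟩ := exists_approx hG X
  obtain ⟨Y, g, δ, hD⟩ := distinguished_cocone_triangle φ
  refine ⟨A, Y, hA, ?_, φ, g, δ, hD⟩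
  intro W f hW
  refine hW.hom_eq_zero (fun i hi f => ?_) f
  have hfδ : f ≫ δ = 0 := by
    let e : (G⟦-i - 1⟧)⟦(1 : ℤ)⟧ ≅ G⟦-i⟧ :=
      (shiftFunctorAdd' T (-i - 1) 1 (-i) (by lia)).symm.app G
    have h₂ : δ ≫ φ⟦(1 : ℤ)⟧' = 0 := comp_distTriang_mor_zero₃₁ _ hD
    obtain ⟨k, hk⟩ := (shiftFunctor T (1 : ℤ)).map_surjective (e.hom ≫ f ≫ δ)
    have h₃ : k = 0 := by
      apply hinj (-i - 1) (by lia) k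
      apply (shiftFunctor T (1 : ℤ)).map_injective
      rw [Functor.map_comp, hk, Category.assoc, Category.assoc, h₂, comp_zero, comp_zero,
        Functor.map_zero]
    rw [← cancel_epi e.hom, ← hk, h₃, Functor.map_zero, comp_zero]
  obtain ⟨f', hf'⟩ := Triangle.coyoneda_exact₃ _ hD f hfδ
  obtain ⟨f'', hf''⟩ := hsurj (-i) (by lia) f'
  have h₁ : φ ≫ g = 0 := comp_distTriang_mor_zero₁₂ _ hD
  rw [hf', hf'']
  change (f'' ≫ φ) ≫ g = 0
  rw [Category.assoc, h₁, comp_zero]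

/-- The t-structure generated by a compact object `G`. Its aisle `T^{≤ 0}` is the smallest full
subcategory which contains all `G[j]`, `j ≥ 0`, and is closed under direct summands, small
coproducts and extensions; its coaisle `T^{≥ 0}` is the right orthogonal of the smallest full
subcategory which contains all `G[j]`, `j ≥ 1`, and has the same closure properties. Moreover
`T^{≤ n} = T^{≤ 0}[-n]` and `T^{≥ n} = T^{≥ 0}[-n]`. -/
noncomputable def tStructure (G : T) (hG : IsCompactObject G) : TStructure T where
  le n := (GenLE G 0).shift n
  ge n := (GenLE G (-1)).rightOrthogonal.shift n
  le_shift n a n' h X hX :=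
    (GenLE G 0).prop_of_iso ((shiftFunctorAdd' T a n' n h).app X) hX
  ge_shift n a n' h X hX :=
    (GenLE G (-1)).rightOrthogonal.prop_of_iso ((shiftFunctorAdd' T a n' n h).app X) hX
  zero' X Y f hX hY := by
    have h₁ : GenLE G 0 X := (GenLE.shift_iff 0 0 0 (by norm_num)).1 hX
    apply (shiftFunctor T (1 : ℤ)).map_injective
    rw [Functor.map_zero]
    exact hY _ (h₁.shift_obj 1 (-1) (by norm_num))
  le_zero_le X hX :=
    (GenLE.shift_obj ((GenLE.shift_iff 0 0 0 (by norm_num)).1 hX) 1 (-1) (by norm_num)).mono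
      (by norm_num)
  ge_one_le Y hY := by
    intro W f hW
    let e : Y⟦(0 : ℤ)⟧ ≅ Y := (shiftFunctorZero T ℤ).app Y
    rw [← cancel_mono e.hom, zero_comp]
    apply (shiftFunctor T (1 : ℤ)).map_injective
    rw [Functor.map_zero]
    exact hY _ ((hW.shift_obj 1 (-2) (by norm_num)).mono (by norm_num))
  exists_triangle_zero_one X := by
    obtain ⟨A, Y, hA, hY, f, g, h, hD⟩ := exists_truncation hG X
    refine ⟨A, Y, (GenLE.shift_iff 0 0 0 (by norm_num)).2 hA, ?_, f, g, h, hD⟩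
    intro W k hW
    let e : (W⟦(-1 : ℤ)⟧)⟦(1 : ℤ)⟧ ≅ W :=
      (shiftFunctorCompIsoId T (-1 : ℤ) 1 (by norm_num)).app W
    obtain ⟨l, hl⟩ := (shiftFunctor T (1 : ℤ)).map_surjective (e.hom ≫ k)
    rw [← cancel_epi e.hom, ← hl, hY l (hW.shift_obj (-1) 0 (by norm_num)), Functor.map_zero,
      comp_zero]

end Triang

section Cohomology

variable {T : Type u} [Category.{v} T] [Preadditive T] [HasZeroObject T] [HasShift T ℤ]
  [∀ n : ℤ, (shiftFunctor T n).Additive] [Pretriangulated T]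

/-- The functor `H^0 = τ^{≥ 0} τ^{≤ 0}` from `T` to the heart of a t-structure. -/
noncomputable def cohomologyZero [IsTriangulated T] (t : TStructure T) :
    T ⥤ t.heart.FullSubcategory :=
  t.heart.lift (t.truncGELE 0 0) fun _ =>
    (t.mem_heart_iff _).2 ⟨inferInstance, inferInstance⟩

/-- The functor `H^i = H^0 ∘ [i]` from `T` to the heart of a t-structure. -/
noncomputable def cohomology [IsTriangulated T] (t : TStructure T) (i : ℤ) :
    T ⥤ t.heart.FullSubcategory :=
  shiftFunctor T i ⋙ cohomologyZero t

/-- `X` is a Brown--Comenetz dual of `C` over `k`: there are isomorphisms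
`Hom(Y, X) ≃ Hom_k(Hom(C, Y), k)` of `k`-vector spaces, natural in `Y`. -/
def IsBrownComenetzDual (k : Type w) [Field k] [Linear k T] (C X : T) : Prop :=
  ∃ e : ∀ Y : T, (Y ⟶ X) ≃ₗ[k] Module.Dual k (C ⟶ Y),
    ∀ ⦃Y Y' : T⦄ (f : Y ⟶ Y') (g : Y' ⟶ X) (h : C ⟶ Y), e Y (f ≫ g) h = e Y' g (h ≫ f)

/-- The Brown--Comenetz dual of the subcategory of compact objects: the smallest thick subcategory
of `T` which contains the Brown--Comenetz duals of all compact objects. -/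
def brownComenetzDual (k : Type w) [Field k] [Linear k T] : ObjectProperty T :=
  ObjectProperty.triangEnvelope fun X => ∃ C : T, IsCompactObject C ∧ IsBrownComenetzDual k C X

/-- The subcategory `T^+_c`: objects `X` such that for all `m > 0` there is a distinguished
triangle `D ⟶ X ⟶ F ⟶ D[1]` with `F` in the Brown--Comenetz dual of the compact objects and
`D` in `T^{≥ m}`. -/
def TPlusC (k : Type w) [Field k] [Linear k T] (t : TStructure T) : ObjectProperty T :=
  fun X => ∀ m : ℤ, 0 < m → ∃ (D F : T) (a : D ⟶ X) (b : X ⟶ F) (c : F ⟶ D⟦(1 : ℤ)⟧),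
    Triangle.mk a b c ∈ distTriang T ∧ brownComenetzDual k F ∧ t.ge m D

/-- A sequence `⋯ ⟶ E 2 ⟶ E 1 ⟶ E 0` of objects satisfying `B` is a strong `B`-coapproximating
system if `H^i(f n)` is an isomorphism for all `i ≤ n + 1`. The indexing starts at `0`, so that
`E n` and `f n : E (n + 1) ⟶ E n` are the object and the morphism at the stage `m = n + 1 ≥ 1`. -/
structure IsStrongCoapproximatingSystem [IsTriangulated T] (t : TStructure T)
    (B : ObjectProperty T) (E : ℕ → T) (f : ∀ n, E (n + 1) ⟶ E n) : Prop where
  mem : ∀ n, B (E n)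
  isIso : ∀ (n : ℕ) (i : ℤ), i ≤ (n : ℤ) + 1 → IsIso ((cohomology t i).map (f n))

/-- `X` is a homotopy limit of the sequence `⋯ ⟶ E 2 ⟶ E 1 ⟶ E 0`: for a product `P` of the
objects `E n` there is a distinguished triangle `X ⟶ P ⟶ P ⟶ X[1]` whose second morphism is
`1 - p`, where the component of `p` at `n` is the projection to `E (n + 1)` followed by `f n`. -/
def IsHomotopyLimit (E : ℕ → T) (f : ∀ n, E (n + 1) ⟶ E n) (X : T) : Prop :=
  ∃ (P : Fan E) (hP : IsLimit P) (g : X ⟶ P.pt) (h : P.pt ⟶ X⟦(1 : ℤ)⟧),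
    Triangle.mk g (𝟙 P.pt - Fan.IsLimit.lift hP fun n => P.proj (n + 1) ≫ f n) h ∈ distTriang T

end Cohomology

end CompactGen

/-! Everything is tested against the aisles. Call a morphism an isomorphism up to degree n if it is
bijective on Hom(W, -) for all W in T^{≤ n} (`IsIsoLE`); this amounts to τ^{≤ n} inverting it.
Between bounded below objects it follows from H^i being invertible for all i ≤ n.

Two facts about the Brown–Comenetz category 𝓔 carry the proof: its objects are bounded below, and
each of them receives no nonzero morphism from T^{≥ b} for b large. For a dual of a compact C, both
translate into the vanishing of Hom(C, -) on T^{≤ -b} and on T^{≥ b} for b large. For C = G[j] the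
first is the vanishing of Ext of G and the second is orthogonality. A general C is handled by
`IsCompactGenerator.exists_forall_eq_zero`: when each Hom(G[j], -) sees only finitely many members
of a sequence, its coproduct is also its product, so compactness of C leaves only finitely many
nonzero morphisms. Thick closure then gives all of 𝓔.

Given a strong system, boundedness below makes f_m an isomorphism up to degree m. The projection
from the homotopy limit to a late stage is then an isomorphism up to high degree
(`IsIsoLE.homotopyLimit_proj`), so its fibre is highly coconnective. Conversely, given triangles D →
X → F with D in T^{≥ m}, the second fact makes D_{m'} → X → F_m vanish for m' large, so a
subsequence of the F's becomes an inverse system under X. The comparison of X with its homotopy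
limit is an isomorphism up to every degree, hence an isomorphism.

The products needed for homotopy limits are built cell by cell from shifts of G, and their universal
property spreads from G to all objects. -/

namespace CompactGen

/-! ### Products in a compactly generated triangulated category -/

section Representability

variable {T : Type u} [Category.{v} T] [Preadditive T] [HasZeroObject T] [HasShift T ℤ]
  [∀ n : ℤ, (shiftFunctor T n).Additive] [Pretriangulated T]

/-- A property of objects which holds for the shifts of `G` and is closed under suspensions,
coproducts and extensions. -/
structure IsLocalizing (G : T) (P : ObjectProperty T) : Prop where
  shift : ∀ j : ℤ, P (G⟦j⟧)
  suspension : ∀ X : T, P X → P (X⟦(1 : ℤ)⟧)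
  coproduct : ∀ {J : Type v} (X : J → T) (c : Cofan X), IsColimit c → (∀ j, P (X j)) → P c.pt
  extension : ∀ D : Triangle T, D ∈ distTriang T → P D.obj₁ → P D.obj₃ → P D.obj₂

section Exactness

variable {X Y Z : T} {f : X ⟶ Y} {g : Y ⟶ Z} {h : Z ⟶ X⟦(1 : ℤ)⟧}

lemma exists_lift₂ (hD : Triangle.mk f g h ∈ distTriang T) {W : T} (u : W ⟶ Y)
    (hu : u ≫ g = 0) : ∃ v : W ⟶ X, v ≫ f = u := by
  obtain ⟨v, hv⟩ := Triangle.coyoneda_exact₂ _ hD u hu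
  exact ⟨v, hv.symm⟩

lemma exists_lift₃ (hD : Triangle.mk f g h ∈ distTriang T) {W : T} (u : W ⟶ Z)
    (hu : u ≫ h = 0) : ∃ v : W ⟶ Y, v ≫ g = u := by
  obtain ⟨v, hv⟩ := Triangle.coyoneda_exact₃ _ hD u hu
  exact ⟨v, hv.symm⟩

lemma comp_zero₁₂ (hD : Triangle.mk f g h ∈ distTriang T) : f ≫ g = 0 :=
  comp_distTriang_mor_zero₁₂ _ hD

lemma comp_zero₂₃ (hD : Triangle.mk f g h ∈ distTriang T) : g ≫ h = 0 :=
  comp_distTriang_mor_zero₂₃ _ hD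

/-- If the first morphism of a triangle is injective on morphisms from the desuspension of `W`,
then the connecting morphism vanishes on morphisms from `W`. -/
lemma comp_connecting_eq_zero (hD : Triangle.mk f g h ∈ distTriang T) {W : T}
    (hW : ∀ u : W⟦(-1 : ℤ)⟧ ⟶ X, u ≫ f = 0 → u = 0) (u : W ⟶ Z) : u ≫ h = 0 := by
  let e : (W⟦(-1 : ℤ)⟧)⟦(1 : ℤ)⟧ ≅ W := (shiftFunctorCompIsoId T (-1 : ℤ) 1 (by norm_num)).app W
  have h₂ : h ≫ f⟦(1 : ℤ)⟧' = 0 := comp_distTriang_mor_zero₃₁ _ hD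
  obtain ⟨k, hk⟩ := (shiftFunctor T (1 : ℤ)).map_surjective (e.hom ≫ u ≫ h)
  have h₃ : k = 0 := by
    apply hW
    apply (shiftFunctor T (1 : ℤ)).map_injective
    rw [Functor.map_comp, hk, Category.assoc, Category.assoc, h₂, comp_zero, comp_zero,
      Functor.map_zero]
  rw [← cancel_epi e.hom, ← hk, h₃, Functor.map_zero, comp_zero]

/-- If the second morphism of a triangle is surjective on morphisms from the suspension of `W`,
then the first morphism is injective on morphisms from `W`. -/
lemma eq_zero_of_comp_eq_zero (hD : Triangle.mk f g h ∈ distTriang T) {W : T}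
    (hW : ∀ u : W⟦(1 : ℤ)⟧ ⟶ Z, ∃ v : W⟦(1 : ℤ)⟧ ⟶ Y, v ≫ g = u) (u : W ⟶ X)
    (hu : u ≫ f = 0) : u = 0 := by
  obtain ⟨v, hv⟩ : ∃ v : W⟦(1 : ℤ)⟧ ⟶ Z, u⟦(1 : ℤ)⟧' = v ≫ h :=
    Triangle.coyoneda_exact₁ _ hD (u⟦(1 : ℤ)⟧')
      (((shiftFunctor T (1 : ℤ)).map_comp u f).symm.trans (by rw [hu, Functor.map_zero]; rfl))
  obtain ⟨v', rfl⟩ := hW v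
  apply (shiftFunctor T (1 : ℤ)).map_injective
  rw [hv, Category.assoc, comp_zero₂₃ hD, comp_zero, Functor.map_zero]

end Exactness

/-- A morphism that induces bijections on `Hom(G[j], -)` for all `j` is an isomorphism. -/
lemma IsCompactGenerator.isIso {G : T} (hG : IsCompactGenerator G) {X Y : T} (φ : X ⟶ Y)
    (h₁ : ∀ (j : ℤ) (f : G⟦j⟧ ⟶ X), f ≫ φ = 0 → f = 0)
    (h₂ : ∀ (j : ℤ) (f : G⟦j⟧ ⟶ Y), ∃ g : G⟦j⟧ ⟶ X, g ≫ φ = f) : IsIso φ := by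
  obtain ⟨Z, a, b, hD⟩ := distinguished_cocone_triangle φ
  refine (Triangle.isZero₃_iff_isIso₁ _ hD).1 (hG.generates Z fun i f => ?_)
  have hb : f ≫ b = 0 := by
    refine comp_connecting_eq_zero hD (fun g hg => ?_) f
    let e : G⟦i + -1⟧ ≅ (G⟦i⟧)⟦(-1 : ℤ)⟧ := (shiftFunctorAdd T i (-1)).app G
    rw [← cancel_epi e.hom, comp_zero]
    exact h₁ _ _ (by rw [Category.assoc, hg, comp_zero])
  obtain ⟨f', rfl⟩ := exists_lift₃ hD f hb
  obtain ⟨g, rfl⟩ := h₂ i f'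
  rw [Category.assoc, comp_zero₁₂ hD, comp_zero]

/-- The mapping telescope of a sequence. -/
lemma exists_telescope [HasCoproducts.{v} T] {G : T} (hG : IsCompactObject G) (B : ℕ → T)
    (p : ∀ n, B n ⟶ B (n + 1)) :
    ∃ (A : T) (c : ∀ n, B n ⟶ A), (∀ n, p n ≫ c (n + 1) = c n) ∧
      (∀ (j : ℤ) (f : G⟦j⟧ ⟶ A), ∃ (N : ℕ) (g : G⟦j⟧ ⟶ B N), f = g ≫ c N) ∧
      (∀ {X : T} (ψ : ∀ n, B n ⟶ X), (∀ n, p n ≫ ψ (n + 1) = ψ n) →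
        ∃ φ : A ⟶ X, ∀ n, c n ≫ φ = ψ n) ∧
      ∀ P : ObjectProperty T, IsLocalizing G P → (∀ n, P (B n)) → P A := by
  classical
  let B' : ULift.{v} ℕ → T := fun n => B n.down
  let ι : ∀ n : ℕ, B n ⟶ ∐ B' := fun n => Sigma.ι B' ⟨n⟩
  let σ : (∐ B') ⟶ ∐ B' := Sigma.desc fun n => p n.down ≫ ι (n.down + 1)
  have hσ : ∀ n, ι n ≫ σ = p n ≫ ι (n + 1) := fun n => by simp [ι, σ]
  obtain ⟨A, q, δ, hD⟩ := distinguished_cocone_triangle (𝟙 (∐ B') - σ)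
  have hq : (𝟙 (∐ B') - σ) ≫ q = 0 := comp_distTriang_mor_zero₁₂ _ hD
  have hιq : ∀ n, p n ≫ ι (n + 1) ≫ q = ι n ≫ q := by
    intro n
    have : ι n ≫ (𝟙 (∐ B') - σ) ≫ q = 0 := by rw [hq, comp_zero]
    rw [Preadditive.sub_comp, Preadditive.comp_sub, Category.id_comp, ← Category.assoc (ι n) σ,
      hσ, Category.assoc, sub_eq_zero] at this
    exact this.symm
  -- If g = gσ, the component of g at 0 vanishes, and the one at m + 1 is the one at m followed by
  -- `p m`. So all components vanish, which forces g = 0 because g is a finite sum through summands.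
  have hinj : ∀ (a : ℤ) (g : G⟦a⟧ ⟶ ∐ B'), g ≫ (𝟙 (∐ B') - σ) = 0 → g = 0 := by
    intro a g hg
    obtain ⟨s, h, hs⟩ := hG.shift_exists_sum a _ (coproductIsCoproduct B') g
    let π : ∀ m : ℕ, (∐ B') ⟶ B m := fun m =>
      Sigma.desc fun n => if e : n.down = m then eqToHom (by subst e; rfl) else 0
    have hπ : ∀ m, ι m ≫ π m = 𝟙 _ := fun m => by simp [ι, π]; rfl
    have hπ' : ∀ n m, n ≠ m → ι n ≫ π m = 0 := fun n m e => by simp [ι, π, e]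
    have hσπ₀ : σ ≫ π 0 = 0 := by
      apply Sigma.hom_ext
      rintro ⟨n⟩
      change ι n ≫ σ ≫ π 0 = ι n ≫ 0
      rw [← Category.assoc, hσ, Category.assoc, hπ' _ _ (by lia), comp_zero, comp_zero]
    have hσπ : ∀ m, σ ≫ π (m + 1) = π m ≫ p m := by
      intro m
      apply Sigma.hom_ext
      rintro ⟨n⟩
      change ι n ≫ σ ≫ π (m + 1) = ι n ≫ π m ≫ p m
      rw [← Category.assoc, hσ, Category.assoc, ← Category.assoc (ι n)]
      by_cases e : n = m
      · subst e
        rw [hπ, hπ, Category.comp_id, Category.id_comp]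
      · rw [hπ' _ _ (by lia), hπ' _ _ e, comp_zero, zero_comp]
    have hgσ : g = g ≫ σ := by
      rwa [Preadditive.comp_sub, Category.comp_id, sub_eq_zero] at hg
    have hgπ : ∀ m, g ≫ π m = 0 := by
      intro m
      induction m with
      | zero => rw [hgσ, Category.assoc, hσπ₀, comp_zero]
      | succ m ih => rw [hgσ, Category.assoc, hσπ, ← Category.assoc, ih, zero_comp]
    have hzero : ∀ n ∈ s, h n = 0 := by
      intro n hn
      have h₁ := hgπ n.down
      rw [hs, Preadditive.sum_comp, Finset.sum_eq_single n] at h₁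
      · rw [Category.assoc] at h₁
        change h n ≫ ι n.down ≫ π n.down = 0 at h₁
        rw [hπ] at h₁
        exact (Category.comp_id _).symm.trans h₁
      · intro n' _ hne
        rw [Category.assoc]
        change h n' ≫ ι n'.down ≫ π n.down = 0
        rw [hπ' _ _ (fun e => hne (ULift.ext _ _ e)), comp_zero]
      · exact fun hn' => absurd hn hn'
    rw [hs]
    exact Finset.sum_eq_zero fun n hn => by rw [hzero n hn, zero_comp]
  refine ⟨A, fun n => ι n ≫ q, hιq, ?_, ?_, ?_⟩
  · intro j f
    have hfδ : f ≫ δ = 0 := by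
      refine comp_connecting_eq_zero hD (fun g hg => ?_) f
      let e : G⟦j + -1⟧ ≅ (G⟦j⟧)⟦(-1 : ℤ)⟧ := (shiftFunctorAdd T j (-1)).app G
      rw [← cancel_epi e.hom, comp_zero]
      exact hinj _ _ (by rw [Category.assoc, hg, comp_zero])
    obtain ⟨f', hf'⟩ := Triangle.coyoneda_exact₃ _ hD f hfδ
    obtain ⟨s, h, hs⟩ := hG.shift_exists_sum j _ (coproductIsCoproduct B') f'
    obtain ⟨N, g, hg⟩ := exists_push_sum p (fun n => ι n ≫ q) hιq
      (s.map ⟨ULift.down, ULift.down_injective⟩) (fun n => h ⟨n⟩)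
    refine ⟨N, g, ?_⟩
    rw [← hg, hf', hs]
    change (∑ j ∈ s, h j ≫ _) ≫ q = _
    rw [Preadditive.sum_comp, Finset.sum_map]
    exact Finset.sum_congr rfl fun n _ => Category.assoc _ _ _
  · intro X ψ hψ
    let ψ' : (∐ B') ⟶ X := Sigma.desc fun n => ψ n.down
    have hψ' : ∀ n, ι n ≫ ψ' = ψ n := fun n => by simp [ι, ψ']
    have hσψ : (𝟙 (∐ B') - σ) ≫ ψ' = 0 := by
      apply Sigma.hom_ext
      rintro ⟨n⟩
      change ι n ≫ (𝟙 (∐ B') - σ) ≫ ψ' = ι n ≫ 0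
      rw [Preadditive.sub_comp, Preadditive.comp_sub, ← Category.assoc (ι n) σ, hσ,
        Category.assoc, hψ', hψ, Category.id_comp, hψ', sub_self, comp_zero]
    obtain ⟨φ, hφ⟩ : ∃ φ : A ⟶ X, ψ' = q ≫ φ := Triangle.yoneda_exact₂ _ hD ψ' hσψ
    exact ⟨φ, fun n => by rw [Category.assoc, ← hφ, hψ']⟩
  · intro P hP hB
    have hB' : P (∐ B') := hP.coproduct B' _ (coproductIsCoproduct B') fun n => hB _
    exact hP.extension _ (rot_of_distTriang _ hD) hB' (hP.suspension _ hB')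

/-- Coning off all morphisms from shifts of G that every `φ i` kills makes them vanish, and each `φ
i` extends over the cone. -/
lemma exists_killing_step_family [HasCoproducts.{v} T] {G : T} {P : ObjectProperty T}
    (hP : IsLocalizing G P) {ι : Type} {X : ι → T} {A : T} (φ : ∀ i, A ⟶ X i) (hA : P A) :
    ∃ (A' : T) (φ' : ∀ i, A' ⟶ X i) (p : A ⟶ A'), P A' ∧ (∀ i, p ≫ φ' i = φ i) ∧
      ∀ (j : ℤ) (f : G⟦j⟧ ⟶ A), (∀ i, f ≫ φ i = 0) → f ≫ p = 0 := by
  let I : Type v := Σ n : ℤ, {f : G⟦n⟧ ⟶ A // ∀ i, f ≫ φ i = 0}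
  let Z : I → T := fun x => G⟦x.1⟧
  let s : (∐ Z) ⟶ A := Sigma.desc fun x => x.2.1
  obtain ⟨A', p, δ, hD⟩ := distinguished_cocone_triangle s
  have hs : ∀ i, s ≫ φ i = 0 := by
    intro i
    apply Sigma.hom_ext
    intro x
    simp [s, x.2.2]
  choose φ' hφ' using fun i => Triangle.yoneda_exact₂ _ hD (φ i) (hs i)
  refine ⟨A', φ', p, ?_, fun i => (hφ' i).symm, ?_⟩
  · have hZ : P (∐ Z) := hP.coproduct Z _ (coproductIsCoproduct Z) fun x => hP.shift _
    exact hP.extension _ (rot_of_distTriang _ hD) hA (hP.suspension _ hZ)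
  · intro j f hf
    have h₁ : f = Sigma.ι Z ⟨j, f, hf⟩ ≫ s := by simp [s]
    have h₂ : s ≫ p = 0 := comp_distTriang_mor_zero₁₂ _ hD
    rw [h₁, Category.assoc, h₂, comp_zero]

/-- For a family of objects `X i` there is an object `A` of the localizing subcategory generated
by `G` with a family of morphisms to the `X i` that is universal for morphisms from the shifts
of `G`. -/
lemma exists_approx_family [HasCoproducts.{v} T] {G : T} (hG : IsCompactObject G)
    {P : ObjectProperty T} (hP : IsLocalizing G P) {ι : Type} (X : ι → T) :
    ∃ (A : T) (φ : ∀ i, A ⟶ X i), P A ∧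
      (∀ (j : ℤ) (f : ∀ i, G⟦j⟧ ⟶ X i), ∃ f' : G⟦j⟧ ⟶ A, ∀ i, f' ≫ φ i = f i) ∧
      ∀ (j : ℤ) (f : G⟦j⟧ ⟶ A), (∀ i, f ≫ φ i = 0) → f = 0 := by
  let S : Type (max u v) := Σ A : {A : T // P A}, ∀ i, A.1 ⟶ X i
  let Z : (Σ n : ℤ, ∀ i, G⟦n⟧ ⟶ X i) → T := fun x => G⟦x.1⟧
  -- One summand for each family of morphisms from a shift of G: surjectivity already holds at this
  -- stage, and the later stages only repair injectivity.
  let a₀ : S := ⟨⟨∐ Z, hP.coproduct _ _ (coproductIsCoproduct _) fun x => hP.shift _⟩,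
    fun i => Sigma.desc fun x => x.2 i⟩
  have step : ∀ a : S, ∃ (b : S) (p : a.1.1 ⟶ b.1.1), (∀ i, p ≫ b.2 i = a.2 i) ∧
      ∀ (j : ℤ) (f : G⟦j⟧ ⟶ a.1.1), (∀ i, f ≫ a.2 i = 0) → f ≫ p = 0 := by
    rintro ⟨⟨A, hA⟩, φ⟩
    obtain ⟨A', φ', p, hA', h⟩ := exists_killing_step_family hP φ hA
    exact ⟨⟨⟨A', hA'⟩, φ'⟩, p, h⟩
  choose next p hp hkill using step
  let a : ℕ → S := fun n => Nat.rec a₀ (fun _ b => next b) n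
  obtain ⟨A, c, hc, hfac, hdesc, hmem⟩ :=
    exists_telescope hG (fun n => (a n).1.1) (fun n => p (a n))
  choose φ hφ using fun i => hdesc (fun n => (a n).2 i) (fun n => hp (a n) i)
  refine ⟨A, φ, hmem P hP fun n => (a n).1.2, ?_, ?_⟩
  · intro j f
    let i₀ : G⟦j⟧ ⟶ (a 0).1.1 := Sigma.ι Z ⟨j, f⟩
    refine ⟨i₀ ≫ c 0, fun i => ?_⟩
    rw [Category.assoc, hφ]
    simp [i₀, a, a₀, Z]
  · intro j f hf
    -- A morphism to the telescope comes from some stage; if all the `φ i` kill it, it dies one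
    -- stage later.
    obtain ⟨N, g, rfl⟩ := hfac j f
    have hg : ∀ i, g ≫ (a N).2 i = 0 := fun i => by rw [← hφ, ← Category.assoc, hf]
    rw [← hc, ← Category.assoc, hkill (a N) j g hg, zero_comp]

/-- The approximation of the one-member family `Y` has its source in `P` and is bijective on
morphisms from all shifts of G, hence is an isomorphism. -/
lemma IsLocalizing.prop [HasCoproducts.{v} T] {G : T} (hG : IsCompactGenerator G)
    {P : ObjectProperty T} [P.IsClosedUnderIsomorphisms] (hP : IsLocalizing G P) (Y : T) :
    P Y := by
  obtain ⟨A, φ, hA, hsurj, hinj⟩ := exists_approx_family hG.compact hP fun _ : Unit => Y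
  have : IsIso (φ ()) := hG.isIso _ (fun j f hf => hinj j f fun _ => hf) fun j f => by
    obtain ⟨f', hf'⟩ := hsurj j fun _ => f
    exact ⟨f', hf' ()⟩
  exact P.prop_of_iso (asIso (φ ())) hA

/-- The objects `Y` all of whose shifts see a family of morphisms as a product. -/
def IsProductFor {ι : Type} {X : ι → T} {A : T} (φ : ∀ i, A ⟶ X i) : ObjectProperty T :=
  fun Y => ∀ n : ℤ, (∀ f : ∀ i, Y⟦n⟧ ⟶ X i, ∃ g : Y⟦n⟧ ⟶ A, ∀ i, g ≫ φ i = f i) ∧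
    ∀ g : Y⟦n⟧ ⟶ A, (∀ i, g ≫ φ i = 0) → g = 0

instance {ι : Type} {X : ι → T} {A : T} (φ : ∀ i, A ⟶ X i) :
    (IsProductFor φ).IsClosedUnderIsomorphisms where
  of_iso {Y Y'} e h n := by
    let e' : Y⟦n⟧ ≅ Y'⟦n⟧ := (shiftFunctor T n).mapIso e
    refine ⟨fun f => ?_, fun g hg => ?_⟩
    · obtain ⟨g, hg⟩ := (h n).1 fun i => e'.hom ≫ f i
      exact ⟨e'.inv ≫ g, fun i => by rw [Category.assoc, hg, Iso.inv_hom_id_assoc]⟩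
    · rw [← cancel_epi e'.hom, comp_zero]
      exact (h n).2 _ fun i => by rw [Category.assoc, hg, comp_zero]

set_option linter.unusedSectionVars false in
lemma IsProductFor.shift {ι : Type} {X : ι → T} {A : T} {φ : ∀ i, A ⟶ X i} {Y : T}
    (h : IsProductFor φ Y) (m : ℤ) : IsProductFor φ (Y⟦m⟧) := by
  intro n
  let e : Y⟦m + n⟧ ≅ (Y⟦m⟧)⟦n⟧ := (shiftFunctorAdd T m n).app Y
  refine ⟨fun f => ?_, fun g hg => ?_⟩
  · obtain ⟨g, hg⟩ := (h (m + n)).1 fun i => e.hom ≫ f i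
    exact ⟨e.inv ≫ g, fun i => by rw [Category.assoc, hg, Iso.inv_hom_id_assoc]⟩
  · rw [← cancel_epi e.hom, comp_zero]
    exact (h (m + n)).2 _ fun i => by rw [Category.assoc, hg, comp_zero]

/-- Morphism extension step of the five lemma, for triangles all of whose rotations are
under control. -/
lemma IsProductFor.extension {ι : Type} {X : ι → T} {A : T} {φ : ∀ i, A ⟶ X i}
    (D : Triangle T) (hD : D ∈ distTriang T) (h₁ : IsProductFor φ D.obj₁)
    (h₃ : IsProductFor φ D.obj₃) : IsProductFor φ D.obj₂ := by
  suffices H : ∀ D : Triangle T, D ∈ distTriang T → IsProductFor φ D.obj₁ →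
      IsProductFor φ D.obj₃ → (∀ f : ∀ i, D.obj₂ ⟶ X i, ∃ g : D.obj₂ ⟶ A, ∀ i, g ≫ φ i = f i) ∧
        ∀ g : D.obj₂ ⟶ A, (∀ i, g ≫ φ i = 0) → g = 0 from
    fun n => H _ (Triangle.shift_distinguished D hD n) (h₁.shift n) (h₃.shift n)
  clear hD h₁ h₃ D
  intro D hD h₁ h₃
  have key : ∀ {Y : T}, IsProductFor φ Y →
      (∀ f : ∀ i, Y ⟶ X i, ∃ g : Y ⟶ A, ∀ i, g ≫ φ i = f i) ∧
        ∀ g : Y ⟶ A, (∀ i, g ≫ φ i = 0) → g = 0 := by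
    intro Y h
    let e : Y⟦(0 : ℤ)⟧ ≅ Y := (shiftFunctorZero T ℤ).app Y
    refine ⟨fun f => ?_, fun g hg => ?_⟩
    · obtain ⟨g, hg⟩ := (h 0).1 fun i => e.hom ≫ f i
      exact ⟨e.inv ≫ g, fun i => by rw [Category.assoc, hg, Iso.inv_hom_id_assoc]⟩
    · rw [← cancel_epi e.hom, comp_zero]
      exact (h 0).2 _ fun i => by rw [Category.assoc, hg, comp_zero]
  -- Exactness one place to the left. Existence uses uniqueness on `D.obj₃⟦-1⟧`, and uniqueness uses
  -- existence on `D.obj₁⟦1⟧`; this is why `IsProductFor` quantifies over all shifts.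
  obtain ⟨w, hw, hw'⟩ : ∃ w : D.obj₃⟦(-1 : ℤ)⟧ ⟶ D.obj₁, w ≫ D.mor₁ = 0 ∧
      ∀ u : D.obj₁ ⟶ A, w ≫ u = 0 → ∃ g : D.obj₂ ⟶ A, u = D.mor₁ ≫ g :=
    have hD' := inv_rot_of_distTriang _ hD
    ⟨D.invRotate.mor₁, comp_distTriang_mor_zero₁₂ _ hD',
      fun u hu => Triangle.yoneda_exact₂ _ hD' u hu⟩
  have z₂₃ := comp_distTriang_mor_zero₂₃ _ hD
  refine ⟨fun f => ?_, fun g hg => ?_⟩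
  · obtain ⟨g₁, hg₁⟩ := (key h₁).1 fun i => D.mor₁ ≫ f i
    obtain ⟨g₂, hg₂⟩ := hw' g₁ ((key (h₃.shift (-1))).2 _ fun i => by
      rw [Category.assoc, hg₁, ← Category.assoc, hw, zero_comp])
    choose r hr using fun i => Triangle.yoneda_exact₂ D hD (f i - g₂ ≫ φ i) (by
      rw [Preadditive.comp_sub, ← Category.assoc, ← hg₂, hg₁, sub_self])
    obtain ⟨g₃, hg₃⟩ := (key h₃).1 r
    refine ⟨g₂ + D.mor₂ ≫ g₃, fun i => ?_⟩
    rw [Preadditive.add_comp, Category.assoc, hg₃, ← hr, add_sub_cancel]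
  · have hg₁ : D.mor₁ ≫ g = 0 := (key h₁).2 _ fun i => by rw [Category.assoc, hg, comp_zero]
    obtain ⟨g₃, rfl⟩ := Triangle.yoneda_exact₂ D hD g hg₁
    choose r hr using fun i => Triangle.yoneda_exact₃ D hD (g₃ ≫ φ i) (by
      rw [← Category.assoc, hg])
    obtain ⟨g₄, hg₄⟩ := (key (h₁.shift 1)).1 r
    have : g₃ - D.mor₃ ≫ g₄ = 0 := (key h₃).2 _ fun i => by
      rw [Preadditive.sub_comp, Category.assoc, hg₄, hr, sub_self]
    rw [sub_eq_zero.1 this, ← Category.assoc, z₂₃, zero_comp]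

set_option linter.unusedSectionVars false in
lemma IsProductFor.coproduct {ι : Type} {X : ι → T} {A : T} {φ : ∀ i, A ⟶ X i} {J : Type v}
    (Y : J → T) (c : Cofan Y) (hc : IsColimit c) (hY : ∀ j, IsProductFor φ (Y j)) :
    IsProductFor φ c.pt := by
  intro n
  have hc' := isColimitShiftCofan c hc n
  refine ⟨fun f => ?_, fun g hg => ?_⟩
  · choose g hg using fun j => (hY j n).1 fun i => (c.inj j)⟦n⟧' ≫ f i
    refine ⟨Cofan.IsColimit.desc hc' g, fun i => ?_⟩
    refine Cofan.IsColimit.hom_ext hc' _ _ fun j => ?_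
    rw [Cofan.IsColimit.fac_assoc, hg]
    rfl
  · refine Cofan.IsColimit.hom_ext hc' _ _ fun j => ?_
    rw [comp_zero]
    exact (hY j n).2 _ fun i => by rw [Category.assoc, hg, comp_zero]

/-- A category with coproducts and a compact generator has countable products, and the product
is detected on the shifts of the generator. -/
lemma IsCompactGenerator.nonempty_isLimit [HasCoproducts.{v} T] {G : T}
    (hG : IsCompactGenerator G) {ι : Type} {X : ι → T} {A : T} (φ : ∀ i, A ⟶ X i)
    (h₁ : ∀ (j : ℤ) (f : ∀ i, G⟦j⟧ ⟶ X i), ∃ f' : G⟦j⟧ ⟶ A, ∀ i, f' ≫ φ i = f i)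
    (h₂ : ∀ (j : ℤ) (f : G⟦j⟧ ⟶ A), (∀ i, f ≫ φ i = 0) → f = 0) :
    Nonempty (IsLimit (Fan.mk A φ)) := by
  have hloc : IsLocalizing G (IsProductFor φ) :=
    { shift := fun j => IsProductFor.shift (fun n => ⟨h₁ n, h₂ n⟩) j
      suspension := fun Y hY => hY.shift 1
      coproduct := fun Y c hc hY => IsProductFor.coproduct Y c hc hY
      extension := IsProductFor.extension }
  have key : ∀ Y : T, (∀ f : ∀ i, Y ⟶ X i, ∃ g : Y ⟶ A, ∀ i, g ≫ φ i = f i) ∧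
      ∀ g : Y ⟶ A, (∀ i, g ≫ φ i = 0) → g = 0 := by
    intro Y
    let e : (Y⟦(-1 : ℤ)⟧)⟦(1 : ℤ)⟧ ≅ Y :=
      (shiftFunctorCompIsoId T (-1 : ℤ) 1 (by norm_num)).app Y
    have h := hloc.prop hG (Y⟦(-1 : ℤ)⟧) 1
    refine ⟨fun f => ?_, fun g hg => ?_⟩
    · obtain ⟨g, hg⟩ := h.1 fun i => e.hom ≫ f i
      exact ⟨e.inv ≫ g, fun i => by rw [Category.assoc, hg, Iso.inv_hom_id_assoc]⟩
    · rw [← cancel_epi e.hom, comp_zero]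
      exact h.2 _ fun i => by rw [Category.assoc, hg, comp_zero]
  choose l hl using fun Y => (key Y).1
  refine ⟨Fan.IsLimit.mk _ (fun s => l _ s.proj) (fun s i => hl _ s.proj i) fun s m hm => ?_⟩
  rw [← sub_eq_zero]
  refine (key _).2 _ fun i => ?_
  rw [Preadditive.sub_comp, hl, ← hm, sub_eq_zero]
  rfl

lemma IsCompactGenerator.exists_isLimit [HasCoproducts.{v} T] {G : T}
    (hG : IsCompactGenerator G) {ι : Type} (X : ι → T) :
    ∃ P : Fan X, Nonempty (IsLimit P) := by
  obtain ⟨A, φ, -, h₁, h₂⟩ := exists_approx_family hG.compact (P := ⊤)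
    ⟨fun _ => trivial, fun _ _ => trivial, fun _ _ _ _ => trivial, fun _ _ _ _ => trivial⟩ X
  exact ⟨_, hG.nonempty_isLimit φ h₁ h₂⟩

end Representability

end CompactGen

namespace CompactGen

/-! ### Orthogonality properties of Brown–Comenetz duals -/

section Vanishing

variable {T : Type u} [Category.{v} T] [Preadditive T] [HasZeroObject T] [HasShift T ℤ]
  [∀ n : ℤ, (shiftFunctor T n).Additive] [Pretriangulated T]

/-- If morphisms from each shift of the generator to `Y a` vanish for large `a`, then so do the
members of any sequence of morphisms from a compact object to the `Y a`. -/
lemma IsCompactGenerator.exists_forall_eq_zero [HasCoproducts.{v} T] {G : T}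
    (hG : IsCompactGenerator G) {C : T} (hC : IsCompactObject C) (Y : ℕ → T)
    (hY : ∀ j : ℤ, ∃ N : ℕ, ∀ a, N ≤ a → ∀ f : G⟦j⟧ ⟶ Y a, f = 0) (g : ∀ a, C ⟶ Y a) :
    ∃ N : ℕ, ∀ a, N ≤ a → g a = 0 := by
  classical
  let Y' : ULift.{v} ℕ → T := fun n => Y n.down
  let ι : ∀ n : ℕ, Y n ⟶ ∐ Y' := fun n => Sigma.ι Y' ⟨n⟩
  let π : ∀ m : ℕ, (∐ Y') ⟶ Y m := fun m =>
    Sigma.desc fun n => if e : n.down = m then eqToHom (by subst e; rfl) else 0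
  have hπ : ∀ m, ι m ≫ π m = 𝟙 _ := fun m => by simp [ι, π]; rfl
  have hπ' : ∀ n m, n ≠ m → ι n ≫ π m = 0 := fun n m e => by simp [ι, π, e]
  have hsum : ∀ {W : T} (s : Finset (ULift.{v} ℕ)) (h : ∀ n : ULift.{v} ℕ, W ⟶ Y n.down) (m : ℕ),
      (∑ n ∈ s, h n ≫ ι n.down) ≫ π m = if ⟨m⟩ ∈ s then h ⟨m⟩ else 0 := by
    intro W s h m
    have : ∀ n ∈ s, n ≠ ⟨m⟩ → (h n ≫ ι n.down) ≫ π m = 0 := fun n _ hn => by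
      rw [Category.assoc, hπ' _ _ (fun e => hn (ULift.ext _ _ e)), comp_zero]
    rw [Preadditive.sum_comp]
    split_ifs with hm
    · rw [Finset.sum_eq_single_of_mem _ hm this, Category.assoc, hπ, Category.comp_id]
    · exact Finset.sum_eq_zero fun n hn => this n hn (by rintro rfl; exact hm hn)
  -- The coproduct is also the product: from `G⟦j⟧` a family of morphisms is zero beyond `N`, so it
  -- is a finite sum through the summands.
  obtain ⟨hlim⟩ := hG.nonempty_isLimit π (fun j f => by
    obtain ⟨N, hN⟩ := hY j
    refine ⟨∑ n ∈ (Finset.range N).map ⟨ULift.up, ULift.up_injective⟩, f n.down ≫ ι n.down,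
      fun m => ?_⟩
    rw [hsum]
    split_ifs with hm
    · rfl
    · exact (hN m (by simpa using hm) _).symm) (fun j f hf => by
    obtain ⟨s, h, hs⟩ := hG.compact.shift_exists_sum j _ (coproductIsCoproduct Y') f
    change f = ∑ n ∈ s, h n ≫ ι n.down at hs
    rw [hs]
    refine Finset.sum_eq_zero fun n hn => ?_
    have := hsum s h n.down
    rw [← hs, hf, if_pos hn] at this
    have h₀ : h n = 0 := this.symm
    rw [h₀, zero_comp])
  let l : C ⟶ ∐ Y' := Fan.IsLimit.lift hlim g
  have hl : ∀ a, l ≫ π a = g a := fun a => Fan.IsLimit.fac hlim g a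
  obtain ⟨s, h, hs⟩ := hC.exists_sum _ (coproductIsCoproduct Y') l
  change l = ∑ n ∈ s, h n ≫ ι n.down at hs
  -- The morphism from C assembled from all the `g a` meets only the finitely many summands in `s`,
  -- so `g a` vanishes past their largest index.
  refine ⟨s.sup (fun n => n.down) + 1, fun a ha => ?_⟩
  rw [← hl, hs, hsum, if_neg]
  intro hmem
  have : a ≤ s.sup (fun n => n.down) :=
    Finset.le_sup (f := fun n : ULift.{v} ℕ => n.down) hmem
  lia

/-- The objects `E` for which morphisms from the members of `S b` to `E` vanish for some `b`. -/
def EventuallyOrthogonal (S : ℤ → ObjectProperty T) : ObjectProperty T :=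
  fun E => ∃ b : ℤ, ∀ X, S b X → ∀ f : X ⟶ E, f = 0

instance (S : ℤ → ObjectProperty T) : (EventuallyOrthogonal S).IsStableUnderRetracts where
  of_retract r := by
    rintro ⟨b, hb⟩
    exact ⟨b, fun X hX f => by
      rw [← Category.comp_id f, ← r.retract, ← Category.assoc, hb X hX (f ≫ r.i), zero_comp]⟩

lemma EventuallyOrthogonal.isTriangulated {S : ℤ → ObjectProperty T} (hS : Antitone S)
    (hshift : ∀ n a : ℤ, ∃ b, ∀ X, S b X → S a (X⟦n⟧)) :
    (EventuallyOrthogonal S).IsTriangulated where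
  exists_zero := ⟨_, isZero_zero T, 0, fun _ _ f => (isZero_zero T).eq_of_tgt f 0⟩
  isStableUnderShiftBy n := ⟨by
    rintro E ⟨a, ha⟩
    obtain ⟨b, hb⟩ := hshift (-n) a
    refine ⟨b, fun X hX f => ?_⟩
    let e : (E⟦n⟧)⟦-n⟧ ≅ E := (shiftEquiv T n).unitIso.symm.app E
    apply (shiftFunctor T (-n)).map_injective
    rw [← cancel_mono e.hom, Functor.map_zero, zero_comp]
    exact ha _ (hb X hX) _⟩
  toIsTriangulatedClosed₂ := .mk' (by
    rintro D hD ⟨a, ha⟩ ⟨b, hb⟩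
    refine ⟨max a b, fun X hX f => ?_⟩
    obtain ⟨g, rfl⟩ := Triangle.coyoneda_exact₂ D hD f (hb X (hS (le_max_right a b) _ hX) _)
    rw [ha X (hS (le_max_left a b) _ hX) g, zero_comp])

/-- Since `EventuallyOrthogonal S` is thick, it suffices to treat the dual of a compact C, where
Hom(X, E) is the dual of Hom(C, X). It is used for `S b` = T^{≥ b} and for `S b` = T^{≤ -b}. -/
lemma brownComenetzDual_le_eventuallyOrthogonal [HasCoproducts.{v} T] (k : Type w) [Field k]
    [Linear k T] {G : T} (hG : IsCompactGenerator G) {S : ℤ → ObjectProperty T} (hS : Antitone S)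
    (hshift : ∀ n a : ℤ, ∃ b, ∀ X, S b X → S a (X⟦n⟧))
    (hGS : ∀ j : ℤ, ∃ b, ∀ X, S b X → ∀ f : G⟦j⟧ ⟶ X, f = 0) :
    brownComenetzDual k ≤ EventuallyOrthogonal S := by
  have := EventuallyOrthogonal.isTriangulated hS hshift
  refine (ObjectProperty.triangEnvelope_le_iff _).2 ?_
  rintro E ⟨C, hC, e, -⟩
  obtain ⟨b, hb⟩ : ∃ b : ℤ, ∀ X, S b X → ∀ f : C ⟶ X, f = 0 := by
    -- Without a bound there would be a nonzero morphism from C to some `Y a` in `S a` for every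
    -- `a`, against `exists_forall_eq_zero`.
    by_contra! H
    choose Y hY g hg using fun a : ℕ => H a
    obtain ⟨N, hN⟩ := hG.exists_forall_eq_zero hC Y (fun j => by
      obtain ⟨b, hb⟩ := hGS j
      exact ⟨b.toNat, fun a ha f => hb _ (hS (by lia) _ (hY a)) f⟩) g
    exact hg N (hN N le_rfl)
  refine ⟨b, fun X hX f => (e X).injective ?_⟩
  rw [map_zero]
  ext h
  rw [hb X hX h, map_zero, map_zero]

end Vanishing

/-! ### Solving equations along an inverse sequence -/

section Tower

variable {T : Type u} [Category.{v} T] [Preadditive T]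

/-- This is surjectivity of 1 - p on Hom(W, -) with one coordinate prescribed. Above K, lift `x n -
y n` along `f n` to obtain `x (n + 1)`; below K, the equation itself determines `x n` from `x (n +
1)`. -/
lemma exists_tower_solution {W : T} (K : ℕ) : ∀ (F : ℕ → T) (f : ∀ n, F (n + 1) ⟶ F n)
    (_ : ∀ n, K ≤ n → ∀ u : W ⟶ F n, ∃ v : W ⟶ F (n + 1), v ≫ f n = u)
    (z : W ⟶ F K) (y : ∀ n, W ⟶ F n),
    ∃ x : ∀ n, W ⟶ F n, x K = z ∧ ∀ n, x n - x (n + 1) ≫ f n = y n := by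
  induction K with
  | zero =>
    intro F f hf z y
    choose s hs using fun n => hf n (Nat.zero_le n)
    refine ⟨fun n => Nat.rec z (fun n x => s n (x - y n)) n, rfl, fun n => ?_⟩
    dsimp only
    rw [hs, sub_sub_cancel]
  | succ K ih =>
    intro F f hf z y
    obtain ⟨x, hx, hxy⟩ := ih (fun n => F (n + 1)) (fun n => f (n + 1))
      (fun n hn => hf (n + 1) (by lia)) z (fun n => y (n + 1))
    refine ⟨fun n => Nat.casesOn n (y 0 + x 0 ≫ f 0) x, hx, fun n => ?_⟩
    cases n with
    | zero => exact add_sub_cancel_right _ _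
    | succ n => exact hxy n

lemma comp_one_sub_lift_proj {F : ℕ → T} (f : ∀ n, F (n + 1) ⟶ F n) {P : Fan F}
    (hP : IsLimit P) {W : T} (u : W ⟶ P.pt) (n : ℕ) :
    (u ≫ (𝟙 P.pt - Fan.IsLimit.lift hP fun n => P.proj (n + 1) ≫ f n)) ≫ P.proj n =
      u ≫ P.proj n - (u ≫ P.proj (n + 1)) ≫ f n := by
  rw [Preadditive.comp_sub, Category.comp_id, Preadditive.sub_comp, Category.assoc,
    Category.assoc, Fan.IsLimit.fac]

end Tower

/-! ### Isomorphisms up to a degree, truncations and cohomology -/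

section TruncIso

variable {T : Type u} [Category.{v} T] [Preadditive T] [HasZeroObject T] [HasShift T ℤ]
  [∀ n : ℤ, (shiftFunctor T n).Additive] [Pretriangulated T]

/-- A morphism is an isomorphism up to degree `n` if it induces bijections on morphisms from the
objects of `t.le n`. -/
structure IsIsoLE (t : TStructure T) (n : ℤ) {X Y : T} (f : X ⟶ Y) : Prop where
  inj : ∀ W : T, t.le n W → ∀ u : W ⟶ X, u ≫ f = 0 → u = 0
  surj : ∀ W : T, t.le n W → ∀ v : W ⟶ Y, ∃ u : W ⟶ X, u ≫ f = v

namespace IsIsoLE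

variable {t : TStructure T} {n : ℤ} {X Y Z : T} {f : X ⟶ Y} {g : Y ⟶ Z}

lemma mono {m : ℤ} (hf : IsIsoLE t n f) (h : m ≤ n) : IsIsoLE t m f :=
  ⟨fun W hW => hf.inj W (t.le_monotone h _ hW), fun W hW => hf.surj W (t.le_monotone h _ hW)⟩

lemma of_comp_right (hg : IsIsoLE t n g) (hfg : IsIsoLE t n (f ≫ g)) : IsIsoLE t n f := by
  refine ⟨fun W hW u hu => hfg.inj W hW u (by rw [← Category.assoc, hu, zero_comp]),
    fun W hW v => ?_⟩
  obtain ⟨u, hu⟩ := hfg.surj W hW (v ≫ g)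
  refine ⟨u, sub_eq_zero.1 (hg.inj W hW _ ?_)⟩
  rw [Preadditive.sub_comp, Category.assoc, hu, sub_self]

lemma of_comp_left (hf : IsIsoLE t n f) (hfg : IsIsoLE t n (f ≫ g)) : IsIsoLE t n g := by
  refine ⟨fun W hW u hu => ?_, fun W hW v => ?_⟩
  · obtain ⟨u, rfl⟩ := hf.surj W hW u
    rw [hfg.inj W hW u (by rwa [← Category.assoc]), zero_comp]
  · obtain ⟨u, rfl⟩ := hfg.surj W hW v
    exact ⟨u ≫ f, Category.assoc _ _ _⟩

lemma comp (hf : IsIsoLE t n f) (hg : IsIsoLE t n g) : IsIsoLE t n (f ≫ g) := by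
  refine ⟨fun W hW u hu => hf.inj W hW u (hg.inj W hW _ (by rwa [Category.assoc])),
    fun W hW v => ?_⟩
  obtain ⟨u, rfl⟩ := hg.surj W hW v
  obtain ⟨u, rfl⟩ := hf.surj W hW u
  exact ⟨u, (Category.assoc _ _ _).symm⟩

lemma of_isIso (f : X ⟶ Y) [IsIso f] : IsIsoLE t n f :=
  ⟨fun W _ u hu => by rwa [← cancel_mono f, zero_comp], fun W _ v => ⟨v ≫ inv f, by simp⟩⟩

lemma of_shift {a m : ℤ} (h : a + m = n) (hf : IsIsoLE t m (f⟦a⟧')) : IsIsoLE t n f := by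
  refine ⟨fun W hW u hu => ?_, fun W hW v => ?_⟩
  · apply (shiftFunctor T a).map_injective
    rw [Functor.map_zero]
    exact hf.inj _ (t.le_shift n a m h W hW) _ (by rw [← Functor.map_comp, hu, Functor.map_zero])
  · obtain ⟨u, hu⟩ := hf.surj _ (t.le_shift n a m h W hW) (v⟦a⟧')
    obtain ⟨u, rfl⟩ := (shiftFunctor T a).map_surjective u
    exact ⟨u, (shiftFunctor T a).map_injective (by rw [Functor.map_comp, hu])⟩

lemma shift (hf : IsIsoLE t n f) {a m : ℤ} (h : a + m = n) : IsIsoLE t m (f⟦a⟧') := by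
  have e : ∀ W : T, t.le m W → ∃ W' : T, t.le n W' ∧ Nonempty (W'⟦a⟧ ≅ W) := fun W hW =>
    ⟨W⟦-a⟧, t.le_shift m (-a) n (by lia) W hW, ⟨(shiftEquiv T a).counitIso.app W⟩⟩
  refine ⟨fun W hW u hu => ?_, fun W hW v => ?_⟩
  · obtain ⟨W', hW', ⟨e⟩⟩ := e W hW
    obtain ⟨u', hu'⟩ := (shiftFunctor T a).map_surjective (e.hom ≫ u)
    rw [← cancel_epi e.hom, ← hu', hf.inj W' hW' u', Functor.map_zero, comp_zero]
    apply (shiftFunctor T a).map_injective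
    rw [Functor.map_comp, hu', Category.assoc, hu, comp_zero, Functor.map_zero]
  · obtain ⟨W', hW', ⟨e⟩⟩ := e W hW
    obtain ⟨v', hv'⟩ := (shiftFunctor T a).map_surjective (e.hom ≫ v)
    obtain ⟨u, rfl⟩ := hf.surj W' hW' v'
    refine ⟨e.inv ≫ u⟦a⟧', ?_⟩
    rw [Category.assoc, ← Functor.map_comp, hv', Iso.inv_hom_id_assoc]

lemma of_ge {a : ℤ} (hX : t.ge a X) (hY : t.ge a Y) (h : n < a) : IsIsoLE t n f :=
  ⟨fun _ hW u _ => t.zero_of_isLE_of_isGE u n a h ⟨hW⟩ ⟨hX⟩, fun _ hW v =>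
    ⟨0, by rw [zero_comp, t.zero_of_isLE_of_isGE v n a h ⟨hW⟩ ⟨hY⟩]⟩⟩

/-- Both Hom(W, X) and Hom(W, X[1]) must vanish for W in T^{≤ n}; as X[1] lies one degree lower than
X, the bound is n + 2. -/
lemma of_triangle {h : Z ⟶ X⟦(1 : ℤ)⟧} (hD : Triangle.mk f g h ∈ distTriang T)
    (hX : t.ge (n + 2) X) : IsIsoLE t n g := by
  refine ⟨fun W hW u hu => ?_, fun W hW v => exists_lift₃ hD v ?_⟩
  · obtain ⟨v, rfl⟩ := exists_lift₂ hD u hu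
    rw [t.zero_of_isLE_of_isGE v n (n + 2) (by lia) ⟨hW⟩ ⟨hX⟩, zero_comp]
  · exact t.zero_of_isLE_of_isGE _ n (n + 1) (by lia) ⟨hW⟩ ⟨t.ge_shift _ 1 _ (by lia) _ hX⟩

lemma ge_of_triangle {h : Z ⟶ X⟦(1 : ℤ)⟧} (hD : Triangle.mk f g h ∈ distTriang T)
    (hg : IsIsoLE t n g) : ∀ W, t.le n W → ∀ u : W ⟶ X, u = 0 := by
  intro W hW u
  refine eq_zero_of_comp_eq_zero hD (fun v => hg.surj _ ?_ v) u
    (hg.inj W hW _ (by rw [Category.assoc, comp_zero₁₂ hD, comp_zero]))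
  exact t.le_monotone (by lia : n - 1 ≤ n) _ (t.le_shift n 1 (n - 1) (by lia) W hW)

/-- The projections from a homotopy limit of a sequence whose transition morphisms are eventually
isomorphisms up to degree `n`. -/
lemma homotopyLimit_proj {E : ℕ → T} {f : ∀ n, E (n + 1) ⟶ E n} {P : Fan E} (hP : IsLimit P)
    {g : X ⟶ P.pt} {h : P.pt ⟶ X⟦(1 : ℤ)⟧}
    (hD : Triangle.mk g (𝟙 P.pt - Fan.IsLimit.lift hP fun n => P.proj (n + 1) ≫ f n) h ∈
      distTriang T) {K : ℕ} (hf : ∀ m, K ≤ m → IsIsoLE t n (f m)) :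
    IsIsoLE t n (g ≫ P.proj K) := by
  have hlift : ∀ W, t.le n W → ∀ (z : W ⟶ E K) (y : W ⟶ P.pt), ∃ x : W ⟶ P.pt,
      x ≫ P.proj K = z ∧
        x ≫ (𝟙 P.pt - Fan.IsLimit.lift hP fun n => P.proj (n + 1) ≫ f n) = y := by
    intro W hW z y
    obtain ⟨x, hx, hxy⟩ := exists_tower_solution K E f (fun m hm => (hf m hm).surj W hW) z
      fun m => y ≫ P.proj m
    refine ⟨Fan.IsLimit.lift hP x, by rw [Fan.IsLimit.fac, hx],
      Fan.IsLimit.hom_ext hP _ _ fun m => ?_⟩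
    rw [comp_one_sub_lift_proj, Fan.IsLimit.fac, Fan.IsLimit.fac, hxy]
  refine ⟨fun W hW u hu => ?_, fun W hW v => ?_⟩
  · have hW' : t.le n (W⟦(1 : ℤ)⟧) :=
      t.le_monotone (by lia : n - 1 ≤ n) _ (t.le_shift n 1 (n - 1) (by lia) W hW)
    -- Surjectivity of 1 - p on Hom(W[1], -) makes `g` injective on Hom(W, -). It remains to see
    -- that all coordinates of `u ≫ g` vanish: above K by injectivity of the `f m`, below K by
    -- compatibility.
    refine eq_zero_of_comp_eq_zero hD (fun y => (hlift _ hW' 0 y).imp fun _ => And.right) u ?_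
    have hstep : ∀ m, ((u ≫ g) ≫ P.proj (m + 1)) ≫ f m = (u ≫ g) ≫ P.proj m := by
      intro m
      have := comp_one_sub_lift_proj f hP (u ≫ g) m
      rw [Category.assoc u g, comp_zero₁₂ hD, comp_zero, zero_comp] at this
      exact (sub_eq_zero.1 this.symm).symm
    have hup : ∀ m, K ≤ m → (u ≫ g) ≫ P.proj m = 0 := by
      intro m hm
      induction m, hm using Nat.le_induction with
      | base => rw [Category.assoc, hu]
      | succ m hm ih => exact (hf m hm).inj W hW _ (by rw [hstep, ih])
    have hdown : ∀ r m, K ≤ m + r → (u ≫ g) ≫ P.proj m = 0 := by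
      intro r
      induction r with
      | zero => exact hup
      | succ r ih => exact fun m hm => by rw [← hstep, ih (m + 1) (by lia), zero_comp]
    exact Fan.IsLimit.hom_ext hP _ _ fun m => by rw [hdown K m (by lia), zero_comp]
  · obtain ⟨x, hx, hx'⟩ := hlift W hW v 0
    obtain ⟨u, rfl⟩ := exists_lift₂ hD x hx'
    exact ⟨u, by rw [← hx, Category.assoc]⟩

end IsIsoLE

section Triangulated

variable (t : TStructure T)

lemma isIsoLE_truncLEι (n : ℤ) (X : T) : IsIsoLE t n ((t.truncLEι n).app X) := by
  refine ⟨fun W hW u hu => ?_, fun W hW v => ?_⟩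
  · have : t.IsLE W n := ⟨hW⟩
    exact t.to_truncLE_obj_ext (by rw [hu, zero_comp])
  · have : t.IsLE W n := ⟨hW⟩
    exact ⟨t.liftTruncLE v n, t.liftTruncLE_ι v n⟩

variable {t} {X Y : T} {f : X ⟶ Y}

/-- The truncation τ^{≤ n} X is itself a test object, so its morphism to X is zero; as this morphism
is injective on Hom(W, -) for W in T^{≤ n}, τ^{≤ n} X is zero. -/
lemma ge_of_hom_eq_zero {n m : ℤ} (h : n + 1 = m) (hX : ∀ W, t.le n W → ∀ u : W ⟶ X, u = 0) :
    t.ge m X := by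
  have : t.IsGE X m := by
    rw [t.isGE_iff_isZero_truncLE_obj n m h, IsZero.iff_id_eq_zero]
    have hle := t.le_of_isLE ((t.truncLE n).obj X) n
    exact (isIsoLE_truncLEι t n X).inj _ hle _ (hX _ hle _)
  exact t.ge_of_isGE X m

lemma isIsoLE_truncLE_map_iff {m n : ℤ} (h : m ≤ n) :
    IsIsoLE t m ((t.truncLE n).map f) ↔ IsIsoLE t m f := by
  have hι := (t.truncLEι n).naturality f
  have hX := (isIsoLE_truncLEι t n X).mono h
  have hY := (isIsoLE_truncLEι t n Y).mono h
  refine ⟨fun hf => hX.of_comp_left ?_, fun hf => hY.of_comp_right ?_⟩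
  · exact hι ▸ hf.comp hY
  · exact hι.symm ▸ hX.comp hf

/-- Yoneda inside T^{≤ n}: the truncated source and target are test objects themselves. -/
lemma isIsoLE_iff_isIso {n : ℤ} : IsIsoLE t n f ↔ IsIso ((t.truncLE n).map f) := by
  rw [← isIsoLE_truncLE_map_iff le_rfl]
  refine ⟨fun hf => ?_, fun _ => .of_isIso _⟩
  have hX := t.le_of_isLE ((t.truncLE n).obj X) n
  have hY := t.le_of_isLE ((t.truncLE n).obj Y) n
  obtain ⟨u, hu⟩ := hf.surj _ hY (𝟙 _)
  refine ⟨u, ?_, hu⟩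
  refine sub_eq_zero.1 (hf.inj _ hX _ ?_)
  rw [Preadditive.sub_comp, Category.assoc, hu, Category.comp_id, Category.id_comp, sub_self]

variable [IsTriangulated T]

lemma IsIsoLE.isIso_cohomology_map {n i : ℤ} (hf : IsIsoLE t n f) (hi : i ≤ n) :
    IsIso ((cohomology t i).map f) := by
  have := isIsoLE_iff_isIso.1 ((hf.mono hi).shift (add_zero i))
  have : IsIso (t.heart.ι.map ((cohomology t i).map f)) :=
    inferInstanceAs (IsIso ((t.truncGE 0).map ((t.truncLE 0).map (f⟦i⟧'))))
  exact isIso_of_reflects_iso _ t.heart.ι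

/-- After shifting i to 0, two of three components are isomorphisms in the morphism of triangles
from τ^{≤ -1} to τ^{≤ 0} to H^0. -/
lemma IsIsoLE.of_isIso_cohomology_map {m i : ℤ} (h : m + 1 = i) (hf : IsIsoLE t m f)
    (hi : IsIso ((cohomology t i).map f)) : IsIsoLE t i f := by
  refine .of_shift (add_zero i) (isIsoLE_iff_isIso.2 ?_)
  have h₁ : IsIsoLE t (-1) ((t.truncLE 0).map (f⟦i⟧')) :=
    (isIsoLE_truncLE_map_iff (by norm_num)).2 (hf.shift (by lia))
  have h₁' := isIsoLE_iff_isIso.1 h₁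
  have h₃ : IsIso (t.heart.ι.map ((cohomology t i).map f)) := inferInstance
  exact isIso₂_of_isIso₁₃ ((t.triangleLEGE (-1) 0 (by norm_num)).map ((t.truncLE 0).map (f⟦i⟧')))
    (t.triangleLEGE_distinguished _ _ _ _) (t.triangleLEGE_distinguished _ _ _ _) h₁' h₃

/-- The common lower bound starts the induction: below degree a all the Hom groups involved are
zero. -/
lemma IsIsoLE.of_forall_isIso_cohomology_map {a n : ℤ} (hX : t.ge a X) (hY : t.ge a Y)
    (h : ∀ i ≤ n, IsIso ((cohomology t i).map f)) : IsIsoLE t n f := by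
  by_cases hn : n < a
  · exact .of_ge hX hY hn
  · have key : ∀ i, a - 1 ≤ i → i ≤ n → IsIsoLE t i f := by
      intro i hi
      induction i, hi using Int.leInduction with
      | base => exact fun _ => .of_ge hX hY (by lia)
      | succ i _ ih => exact fun hi => (ih (by lia)).of_isIso_cohomology_map rfl (h _ hi)
    exact key n (by lia) le_rfl

end Triangulated

end TruncIso

end CompactGen

namespace CompactGen

/-! ### Coapproximating systems for the t-structure generated by G -/

section Generated

variable {T : Type u} [Category.{v} T] [Preadditive T] [HasZeroObject T] [HasShift T ℤ]
  [∀ n : ℤ, (shiftFunctor T n).Additive] [Pretriangulated T] [HasCoproducts.{v} T] {G : T}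

lemma tStructure_le_iff (hG : IsCompactObject G) (n : ℤ) (X : T) :
    (tStructure G hG).le n X ↔ GenLE G n X :=
  GenLE.shift_iff n n 0 (by lia)

lemma tStructure_le_shift_generator (hG : IsCompactObject G) (j : ℤ) :
    (tStructure G hG).le (-j) (G⟦j⟧) := by
  rw [tStructure_le_iff]
  exact (GenLE.shift (G := G) (-j) le_rfl).of_iso (eqToIso (by rw [neg_neg]))

omit [HasCoproducts.{v} T] in
-- On generators, Hom(G[j], G[-i]) is Hom(G, G[-i - j]), which vanishes once i ≤ -n - j. Compactness
-- of G carries the vanishing through coproducts.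
lemma GenLE.hom_eq_zero_of_vanishing (hG : IsCompactObject G) {n : ℤ}
    (hn : ∀ i : ℤ, n ≤ i → ∀ f : G ⟶ G⟦i⟧, f = 0) {j b : ℤ} (hb : b ≤ -n - j) {X : T}
    (hX : GenLE G b X) (f : G⟦j⟧ ⟶ X) : f = 0 := by
  induction hX with
  | shift i hi =>
    let e : (G⟦-i - j⟧)⟦j⟧ ≅ G⟦-i⟧ := (shiftFunctorAdd' T (-i - j) j (-i) (by lia)).symm.app G
    obtain ⟨u, hu⟩ := (shiftFunctor T j).map_surjective (f ≫ e.inv)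
    rw [← cancel_mono e.inv, ← hu, hn _ (by lia) u, Functor.map_zero, zero_comp]
  | retract r _ ih =>
    rw [← Category.comp_id f, ← r.retract, ← Category.assoc, ih (f ≫ r.i), zero_comp]
  | coproduct X c hc _ ih =>
    obtain ⟨s, g, rfl⟩ := hG.shift_exists_sum j c hc f
    exact Finset.sum_eq_zero fun i _ => by rw [ih i (g i), zero_comp]
  | extension D hD _ _ h₁ h₃ =>
    obtain ⟨g, rfl⟩ := Triangle.coyoneda_exact₂ D hD f (h₃ _)
    rw [h₁ g, zero_comp]

lemma exists_isHomotopyLimit (hG : IsCompactGenerator G) (E : ℕ → T)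
    (f : ∀ n, E (n + 1) ⟶ E n) : ∃ X : T, IsHomotopyLimit E f X := by
  obtain ⟨P, ⟨hP⟩⟩ := hG.exists_isLimit E
  obtain ⟨X, g, h, hD⟩ := distinguished_cocone_triangle₁
    (𝟙 P.pt - Fan.IsLimit.lift hP fun n => P.proj (n + 1) ≫ f n)
  exact ⟨X, P, hP, g, h, hD⟩

omit [HasCoproducts.{v} T] in
lemma distinguished_of_iso₁ {X X' Y Z : T} {g : X' ⟶ Y} {d : Y ⟶ Z} {h : Z ⟶ X'⟦(1 : ℤ)⟧}
    (hD : Triangle.mk g d h ∈ distTriang T) (e : X ≅ X') :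
    Triangle.mk (e.hom ≫ g) d (h ≫ e.inv⟦(1 : ℤ)⟧') ∈ distTriang T := by
  refine isomorphic_distinguished _ hD _
    (Triangle.isoMk _ _ e (Iso.refl Y) (Iso.refl Z) ?_ ?_ ?_)
  · exact Category.comp_id (e.hom ≫ g)
  · exact (Category.comp_id d).trans (Category.id_comp d).symm
  · change (h ≫ e.inv⟦(1 : ℤ)⟧') ≫ e.hom⟦(1 : ℤ)⟧' = 𝟙 Z ≫ h
    rw [Category.assoc, ← Functor.map_comp, e.inv_hom_id, CategoryTheory.Functor.map_id, Category.comp_id,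
      Category.id_comp]

/-- An object that is compatibly approximated by the members of a sequence in increasing degrees
is a homotopy limit of that sequence. -/
lemma isHomotopyLimit_of_isIsoLE (hG : IsCompactGenerator G) {E : ℕ → T}
    {f : ∀ n, E (n + 1) ⟶ E n} {X : T} (b : ∀ n, X ⟶ E n) (hb : ∀ n, b (n + 1) ≫ f n = b n)
    (hb' : ∀ n : ℕ, IsIsoLE (tStructure G hG.compact) (n + 1) (b n)) : IsHomotopyLimit E f X := by
  set t := tStructure G hG.compact
  have hf : ∀ n : ℕ, IsIsoLE t (n + 1) (f n) := fun n =>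
    ((hb' (n + 1)).mono (by lia)).of_comp_left (by rw [hb]; exact hb' n)
  obtain ⟨X', P, hP, g, h, hD⟩ := exists_isHomotopyLimit hG E f
  -- The comparison with a homotopy limit X'. In each degree both X and X' agree with a late stage
  -- of the sequence, and every `G⟦j⟧` lies in some T^{≤ n}, so φ is an isomorphism.
  obtain ⟨φ, hφ⟩ := exists_lift₂ hD (Fan.IsLimit.lift hP b) (Fan.IsLimit.hom_ext hP _ _ fun n => by
    rw [comp_one_sub_lift_proj, Fan.IsLimit.fac, Fan.IsLimit.fac, hb, sub_self, zero_comp])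
  have hφ' : ∀ n : ℤ, IsIsoLE t n φ := by
    intro n
    have hg : IsIsoLE t n (g ≫ P.proj n.toNat) :=
      IsIsoLE.homotopyLimit_proj hP hD fun m hm => (hf m).mono (by lia)
    refine hg.of_comp_right ?_
    rw [← Category.assoc, hφ, Fan.IsLimit.fac]
    exact (hb' _).mono (by lia)
  have : IsIso φ := hG.isIso φ
    (fun j => (hφ' (-j)).inj _ (tStructure_le_shift_generator hG.compact j))
    (fun j => (hφ' (-j)).surj _ (tStructure_le_shift_generator hG.compact j))
  exact ⟨P, hP, φ ≫ g, _, distinguished_of_iso₁ hD (asIso φ)⟩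

variable (k : Type w) [Field k] [Linear k T]

/-- Morphisms from sufficiently coconnective objects to an object of the Brown--Comenetz dual
vanish. -/
lemma brownComenetzDual_exists_ge (hG : IsCompactGenerator G) {E : T}
    (hE : brownComenetzDual k E) :
    ∃ b : ℤ, ∀ X, (tStructure G hG.compact).ge b X → ∀ f : X ⟶ E, f = 0 := by
  set t := tStructure G hG.compact
  refine brownComenetzDual_le_eventuallyOrthogonal k hG (S := t.ge) t.ge_antitone
    (fun n a => ⟨a + n, fun X hX => t.ge_shift _ n _ (by lia) X hX⟩)
    (fun j => ⟨-j + 1, fun X hX f => ?_⟩) E hE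
  exact t.zero_of_isLE_of_isGE f (-j) (-j + 1) (by lia)
    ⟨tStructure_le_shift_generator hG.compact j⟩ ⟨hX⟩

/-- If the positive self-extensions of the generator eventually vanish, then the objects of the
Brown--Comenetz dual are bounded below. -/
lemma brownComenetzDual_bounded_below (hG : IsCompactGenerator G)
    (hvanish : ∃ n : ℤ, 0 < n ∧ ∀ i : ℤ, n ≤ i → ∀ f : G ⟶ G⟦i⟧, f = 0) {E : T}
    (hE : brownComenetzDual k E) : ∃ a : ℤ, (tStructure G hG.compact).ge a E := by
  obtain ⟨n, -, hn⟩ := hvanish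
  set t := tStructure G hG.compact with ht
  obtain ⟨b, hb⟩ := brownComenetzDual_le_eventuallyOrthogonal k hG (S := fun b => t.le (-b))
    (fun a b hab => t.le_monotone (by lia))
    (fun m a => ⟨a - m, fun X hX => t.le_shift _ m _ (by lia) X hX⟩)
    (fun j => ⟨n + j, fun X hX f =>
      ((tStructure_le_iff hG.compact _ X).1 hX).hom_eq_zero_of_vanishing hG.compact hn
        (by lia) f⟩) E hE
  exact ⟨-b + 1, ge_of_hom_eq_zero rfl hb⟩

variable [IsTriangulated T] {k}

/-- Cohomology alone does not control τ^{≤ n + 1}; boundedness below of the members of 𝓔 closes the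
gap. -/
lemma isIsoLE_of_isStrongCoapproximatingSystem (hG : IsCompactGenerator G)
    (hvanish : ∃ n : ℤ, 0 < n ∧ ∀ i : ℤ, n ≤ i → ∀ f : G ⟶ G⟦i⟧, f = 0)
    {E : ℕ → T} {f : ∀ n, E (n + 1) ⟶ E n}
    (hE : IsStrongCoapproximatingSystem (tStructure G hG.compact) (brownComenetzDual k) E f)
    (n : ℕ) : IsIsoLE (tStructure G hG.compact) (n + 1) (f n) := by
  obtain ⟨a, ha⟩ := brownComenetzDual_bounded_below k hG hvanish (hE.mem n)
  obtain ⟨b, hb⟩ := brownComenetzDual_bounded_below k hG hvanish (hE.mem (n + 1))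
  set t := tStructure G hG.compact
  exact .of_forall_isIso_cohomology_map (t.ge_antitone (min_le_left b a) _ hb)
    (t.ge_antitone (min_le_right b a) _ ha) (hE.isIso n)

lemma tPlusC_of_isHomotopyLimit (hG : IsCompactGenerator G)
    (hvanish : ∃ n : ℤ, 0 < n ∧ ∀ i : ℤ, n ≤ i → ∀ f : G ⟶ G⟦i⟧, f = 0)
    {E : ℕ → T} {f : ∀ n, E (n + 1) ⟶ E n}
    (hE : IsStrongCoapproximatingSystem (tStructure G hG.compact) (brownComenetzDual k) E f)
    {X : T} (hX : IsHomotopyLimit E f X) : TPlusC k (tStructure G hG.compact) X := by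
  intro m _
  obtain ⟨P, hP, g, h, hD⟩ := hX
  have hb : IsIsoLE (tStructure G hG.compact) m (g ≫ P.proj m.toNat) :=
    IsIsoLE.homotopyLimit_proj hP hD fun n hn =>
      (isIsoLE_of_isStrongCoapproximatingSystem hG hvanish hE n).mono (by lia)
  obtain ⟨D, a, c, hD'⟩ := distinguished_cocone_triangle₁ (g ≫ P.proj m.toNat)
  exact ⟨D, _, a, _, c, hD', hE.mem _,
    TStructure.ge_antitone _ (by lia : m ≤ m + 1) _
      (ge_of_hom_eq_zero rfl (hb.ge_of_triangle hD'))⟩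

lemma exists_isStrongCoapproximatingSystem (hG : IsCompactGenerator G) {X : T}
    (hX : TPlusC k (tStructure G hG.compact) X) :
    ∃ (E : ℕ → T) (f : ∀ n, E (n + 1) ⟶ E n),
      IsStrongCoapproximatingSystem (tStructure G hG.compact) (brownComenetzDual k) E f ∧
      IsHomotopyLimit E f X := by
  set t := tStructure G hG.compact
  -- With n ≤ `N n`, the shift by 3 puts `D (N n)` in T^{≥ (n + 1) + 2}, as `IsIsoLE.of_triangle`
  -- needs in degree n + 1.
  choose D F a b c hD hF hDge using fun m : ℕ => hX ((m : ℤ) + 3) (by lia)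
  choose d hd using fun m => brownComenetzDual_exists_ge k hG (hF m)
  -- The next index is at least `d (N n)`, so the next `D` has no nonzero morphism to `F (N n)`, and
  -- `b (N n)` factors through `b (N (n + 1))`.
  let N : ℕ → ℕ := fun n => Nat.rec 0 (fun _ m => max (m + 1) (d m).toNat) n
  have hNs : ∀ n, N (n + 1) = max (N n + 1) (d (N n)).toNat := fun _ => rfl
  have hN : ∀ n, n ≤ N n := by
    intro n
    induction n with
    | zero => exact Nat.zero_le _
    | succ n ih => rw [hNs]; lia
  have hlift : ∀ n, ∃ f : F (N (n + 1)) ⟶ F (N n), b (N (n + 1)) ≫ f = b (N n) := by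
    intro n
    obtain ⟨f, hf⟩ := Triangle.yoneda_exact₂ _ (hD (N (n + 1))) (b (N n))
      (hd (N n) _ (t.ge_antitone (by rw [hNs]; lia) _ (hDge (N (n + 1)))) _)
    exact ⟨f, hf.symm⟩
  choose f hf using hlift
  have hb : ∀ n : ℕ, IsIsoLE t (n + 1) (b (N n)) := fun n =>
    IsIsoLE.of_triangle (hD (N n)) (t.ge_antitone (by have := hN n; lia) _ (hDge (N n)))
  refine ⟨fun n => F (N n), f, ⟨fun n => hF _, fun n i hi => ?_⟩,
    isHomotopyLimit_of_isIsoLE hG (fun n => b (N n)) hf hb⟩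
  have hfn : IsIsoLE t (n + 1) (f n) :=
    ((hb (n + 1)).mono (by lia)).of_comp_left (by rw [hf]; exact hb n)
  exact hfn.isIso_cohomology_map hi

end Generated

end CompactGen

theorem mainTheorem6 {k : Type w} [Field k]
    {T : Type u} [Category.{v} T] [Preadditive T] [Linear k T] [HasZeroObject T] [HasShift T ℤ]
    [∀ n : ℤ, (shiftFunctor T n).Additive] [∀ n : ℤ, (shiftFunctor T n).Linear k]
    [Pretriangulated T] [IsTriangulated T] [HasCoproducts.{v} T]
    (G : T) (hG : CompactGen.IsCompactGenerator G)
    (hvanish : ∃ n : ℤ, 0 < n ∧ ∀ i : ℤ, n ≤ i → ∀ f : G ⟶ G⟦i⟧, f = 0)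
    (hprod : ∀ J : Type v,
      ((CompactGen.tStructure G hG.compact).le 0).IsClosedUnderLimitsOfShape (Discrete J)) :
    (∀ F : T, CompactGen.TPlusC k (CompactGen.tStructure G hG.compact) F ↔
      ∃ (E : ℕ → T) (f : ∀ n, E (n + 1) ⟶ E n),
        CompactGen.IsStrongCoapproximatingSystem (CompactGen.tStructure G hG.compact)
          (CompactGen.brownComenetzDual k) E f ∧
        CompactGen.IsHomotopyLimit E f F) ∧
    (∀ (E : ℕ → T) (f : ∀ n, E (n + 1) ⟶ E n),
      CompactGen.IsStrongCoapproximatingSystem (CompactGen.tStructure G hG.compact)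
        (CompactGen.brownComenetzDual k) E f →
      ∃ F : T, CompactGen.IsHomotopyLimit E f F) := by
  refine ⟨fun F => ⟨CompactGen.exists_isStrongCoapproximatingSystem hG, ?_⟩, fun E f _ =>
    CompactGen.exists_isHomotopyLimit hG E f⟩
  rintro ⟨E, f, hE, hF⟩
  exact CompactGen.tPlusC_of_isHomotopyLimit hG hvanish hE hF
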